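/- Let $m\in\mathbb N\cup\{0\}$. There is a constant $c(m)>0$ depending only on $m$ such that the following holds. Let $\eta_-,\eta_+\subset\mathbb R^2$ be two parallel lines at distance $d_0>0$, and let $\gamma_0:[-1,1]\to\mathbb R^2$ be a smooth immersed curve with $\gamma_0(\pm1)\in\eta_\pm$, with winding number $\frac1{2\pi}\int_{\gamma_0} k\,ds=0$, and satisfying the generalised Neumann boundary conditions: $\gamma_0$ meets $\eta_\pm$ orthogonally at $\pm1$, and $k_{s^{2l+1}}(\pm1)=0$ for $l=0,\dots,m$. Here, for an immersed curve $\gamma$, $s$ is arclength, $\nu$ is the unit normal obtained by rotating the unit tangent by $+\pi/2$, $k$ is the curvature, $\gamma_{ss}=k\nu$, and $k_{s^j}$ is its $j$-th arclength derivative. Let $L_0$ be the length of $\gamma_0$ and suppose that $$L_0^{2m+1}\int_{\gamma_0}k_{s^m}^2\,ds\le c(m).$$ Let $0<T\le\infty$ and let $\gamma:[-1,1]\times[0,T)\to\mathbb R^2$ be a solution of the $L^2$-gradient flow $$\frac{\partial\gamma}{\partial t}=\Big[(-1)^{m+1}k_{s^{2m+2}}-\sum_{j=1}^m(-1)^j\,k\,k_{s^{m+j}}k_{s^{m-j}}-\tfrac12\,k\,k_{s^m}^2\Big]\nu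 ,\qquad \gamma(\cdot,0)=\gamma_0,$$ of $\frac12\int k_{s^m}^2\,ds$, such that every $\gamma(\cdot,t)$ is immersed, has its end points $\gamma(\pm1,t)$ on $\eta_\pm$, and satisfies the same generalised Neumann boundary conditions; $\gamma$ is smooth on $[-1,1]\times(0,T)$, the equation holds for $0<t<T$, and the space derivatives of $\gamma$ up to order $m+2$ are continuous on $[-1,1]\times[0,T)$. Then $\int k^2\,ds$ decays exponentially: there is $\delta>0$ depending only on $m$ and $L_0$ such that $$\int_{\gamma(\cdot,t)}k^2\,ds\le e^{-\delta t}\int_{\gamma_0}k^2\,ds\qquad\text{for all }t\in[0,T).$$ -/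

import Mathlib

open Set MeasureTheory
open scoped ContDiff

namespace CurveFlow

noncomputable section

/-- The Euclidean plane. -/
abbrev Plane : Type := EuclideanSpace ℝ (Fin 2)

/-- Rotation of the plane by a quarter turn, counterclockwise. -/
def rot (v : Plane) : Plane := !₂[-v 1, v 0]

/-- The parameter interval `[-1, 1]`. All derivatives in the space variable are taken within it,
hence they are one-sided at the two end points. -/
abbrev I : Set ℝ := Icc (-1) 1

/-- The speed `|c'(x)|` of a parametrised curve; the arclength element is `ds = speed c x dx`. -/
def speed (c : ℝ → Plane) (x : ℝ) : ℝ := ‖derivWithin c I x‖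

/-- The derivative `f_s` with respect to the arclength parameter of `c`. -/
def arcDeriv (c : ℝ → Plane) {E : Type} [NormedAddCommGroup E] [NormedSpace ℝ E]
    (f : ℝ → E) (x : ℝ) : E := (speed c x)⁻¹ • derivWithin f I x

/-- The unit tangent `c_s`. -/
def tangent (c : ℝ → Plane) : ℝ → Plane := arcDeriv c c

/-- The unit normal. -/
def normal (c : ℝ → Plane) (x : ℝ) : Plane := rot (tangent c x)

/-- The curvature, given by `c_ss = k ν`. -/
def curvature (c : ℝ → Plane) (x : ℝ) : ℝ := inner ℝ (arcDeriv c (tangent c) x) (normal c x)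

/-- The `j`-th iterated arclength derivative of the curvature. -/
def curvatureDeriv (c : ℝ → Plane) (j : ℕ) : ℝ → ℝ := (arcDeriv c)^[j] (curvature c)

/-- The integral `∫ f ds` along the curve. -/
def arcIntegral (c : ℝ → Plane) (f : ℝ → ℝ) : ℝ := ∫ x in (-1 : ℝ)..1, f x * speed c x

/-- The length of the curve. -/
def length (c : ℝ → Plane) : ℝ := arcIntegral c fun _ => 1

/-- The winding number `(1 / 2π) ∫ k ds`. -/
def windingNumber (c : ℝ → Plane) : ℝ := (1 / (2 * Real.pi)) * arcIntegral c (curvature c)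

/-- The energy `∫ (k_{s^m})² ds`. -/
def energy (m : ℕ) (c : ℝ → Plane) : ℝ := arcIntegral c fun x => curvatureDeriv c m x ^ 2

/-- The normal speed
`F = (-1)^(m+1) k_{s^(2m+2)} - ∑_{j=1}^m (-1)^j k k_{s^(m+j)} k_{s^(m-j)} - (1/2) k (k_{s^m})²`. -/
def flowSpeed (m : ℕ) (c : ℝ → Plane) (x : ℝ) : ℝ :=
  (-1) ^ (m + 1) * curvatureDeriv c (2 * m + 2) x
    - ∑ j ∈ Finset.Icc 1 m,
        (-1) ^ j * (curvature c x * curvatureDeriv c (m + j) x * curvatureDeriv c (m - j) x)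
    - 1 / 2 * curvature c x * curvatureDeriv c m x ^ 2

/-- `c` is a regular (immersed) curve; it need not be embedded. -/
def IsRegular (c : ℝ → Plane) : Prop := ∀ x ∈ I, derivWithin c I x ≠ 0

/-- The line orthogonal to the unit vector `e` at signed distance `a` from the origin. -/
def line (e : Plane) (a : ℝ) : Set Plane := {p | inner ℝ p e = a}

/-- The generalised Neumann boundary conditions of order `m` on the parallel lines
`line e a` and `line e (a + d)`: the end points lie on the lines, the curve meets the lines
orthogonally (`rot e` spans their direction), and the derivatives of the curvature of orders
`1, 3, …, 2m + 1` vanish at both end points. -/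
structure NeumannBC (m : ℕ) (e : Plane) (a d : ℝ) (c : ℝ → Plane) : Prop where
  mem_left : c (-1) ∈ line e a
  mem_right : c 1 ∈ line e (a + d)
  orthogonal : ∀ x ∈ ({-1, 1} : Set ℝ), inner ℝ (derivWithin c I x) (rot e) = 0
  odd_deriv : ∀ x ∈ ({-1, 1} : Set ℝ), ∀ l ≤ m, curvatureDeriv c (2 * l + 1) x = 0

/-- `γ` (in the variables `x`, `t`) is a solution on `[-1, 1] × [0, T)`, where `0 < T ≤ ∞`, of the
flow `∂γ/∂t = F ν` with generalised Neumann boundary conditions and initial curve `γ₀`. It is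
smooth on `[-1, 1] × (0, T)`, and takes on the initial curve continuously together with
its space derivatives up to order `m + 2`, the order of the energy. -/
structure IsSolution (m : ℕ) (e : Plane) (a d : ℝ) (γ₀ : ℝ → Plane) (T : EReal)
    (γ : ℝ → ℝ → Plane) : Prop where
  smooth : ContDiffOn ℝ ∞ (fun p : ℝ × ℝ => γ p.1 p.2) (I ×ˢ {t : ℝ | 0 < t ∧ (t : EReal) < T})
  continuous : ∀ i ≤ m + 2,
    ContinuousOn (fun p : ℝ × ℝ => iteratedDerivWithin i (fun x => γ x p.2) I p.1)
      (I ×ˢ {t : ℝ | 0 ≤ t ∧ (t : EReal) < T})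
  initial : ∀ x ∈ I, γ x 0 = γ₀ x
  regular : ∀ t : ℝ, 0 ≤ t → (t : EReal) < T → IsRegular fun x => γ x t
  boundary : ∀ t : ℝ, 0 ≤ t → (t : EReal) < T → NeumannBC m e a d fun x => γ x t
  flow : ∀ t : ℝ, 0 < t → (t : EReal) < T → ∀ x ∈ I,
    HasDerivAt (fun τ => γ x τ) (flowSpeed m (fun y => γ y t) x • normal (fun y => γ y t) x) t

end

end CurveFlow

/-! Write L for the length, F for the normal speed and a_i for the L²(ds)-norm of k_{s^i}.
Everything is controlled by the scale-invariant quantity L∫k² ds: while it is small, both factors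
are nonincreasing, so it stays small, and ∫k² satisfies a linear differential inequality.

Poincaré inequalities come from zeros. Each k_{s^j} with j ≤ 2m+2 vanishes somewhere: for odd j at
the end points, for even j because its integral is zero (for j = 0 this is the winding number, which
the flow preserves). Hence |k_{s^j}|² ≤ 2 a_j a_{j+1} pointwise and a_j ≤ 2L a_{j+1}. This turns the
hypothesis into smallness of L∫k² and makes the dissipation coercive.

Along the flow, L' = -∫kF and (∫k²)' = 2∫k_{ss}F + ∫k³F. The boundary terms vanish since k_s = 0 and
F_s = 0 at the end points; the latter follows by differentiating the orthogonality condition in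
time. Integration by parts gives the leading terms -a_{m+1}² and -2a_{m+2}²; the remaining terms are
quartic or sextic in the curvature.

These errors are absorbed by interpolation. The sequence a_i is log-convex, so a_i ≤ a_0 ρ^i for i ≤
N, with equality at i = N (`exists_ratio`). Hence |k_{s^i}| ≤ √(2a_0²ρ) ρ^i for i < N, and once
derivatives are moved off the highest factor each error is at most a constant times L a_0² a_N².
Therefore L' ≤ 0 and (∫k²)' ≤ -a_{m+2}² ≤ -(2L)^{-2(m+2)}∫k² (`dissipation`). The continuity
argument `exp_decay_of_small` and L ≤ L₀ finish the proof. -/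

namespace CurveFlow

/-! ### Arclength derivatives on the closed interval -/

section Calculus

theorem uniqueDiffOn_I : UniqueDiffOn ℝ I := uniqueDiffOn_Icc (by norm_num)

theorem left_mem_I : (-1 : ℝ) ∈ I := ⟨le_rfl, by norm_num⟩

theorem right_mem_I : (1 : ℝ) ∈ I := ⟨by norm_num, le_rfl⟩

variable {c : ℝ → Plane} {E : Type} [NormedAddCommGroup E] [NormedSpace ℝ E]

theorem contDiffOn_derivWithin {f : ℝ → E} (hf : ContDiffOn ℝ ∞ f I) :
    ContDiffOn ℝ ∞ (derivWithin f I) I :=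
  hf.derivWithin uniqueDiffOn_I (by simp)

theorem differentiableWithinAt_of_smooth {f : ℝ → E} (hf : ContDiffOn ℝ ∞ f I) {x : ℝ}
    (hx : x ∈ I) : DifferentiableWithinAt ℝ f I x :=
  (hf.differentiableOn (by simp)) x hx

theorem speed_pos (hr : IsRegular c) {x : ℝ} (hx : x ∈ I) : 0 < speed c x :=
  norm_pos_iff.2 (hr x hx)

theorem speed_nonneg (x : ℝ) : 0 ≤ speed c x := norm_nonneg _

theorem contDiffOn_speed (hc : ContDiffOn ℝ ∞ c I) (hr : IsRegular c) :
    ContDiffOn ℝ ∞ (speed c) I :=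
  (contDiffOn_derivWithin hc).norm ℝ hr

theorem contDiffOn_arcDeriv (hc : ContDiffOn ℝ ∞ c I) (hr : IsRegular c) {f : ℝ → E}
    (hf : ContDiffOn ℝ ∞ f I) : ContDiffOn ℝ ∞ (arcDeriv c f) I :=
  ((contDiffOn_speed hc hr).inv fun _ hx => (speed_pos hr hx).ne').smul
    (contDiffOn_derivWithin hf)

theorem contDiffOn_arcDeriv_iterate (hc : ContDiffOn ℝ ∞ c I) (hr : IsRegular c) {f : ℝ → E}
    (hf : ContDiffOn ℝ ∞ f I) (n : ℕ) : ContDiffOn ℝ ∞ ((arcDeriv c)^[n] f) I := by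
  induction n with
  | zero => exact hf
  | succ n ih =>
    rw [Function.iterate_succ_apply']
    exact contDiffOn_arcDeriv hc hr ih

/-- This default value makes the sum and product rules equalities of functions on all of ℝ, so they
can be rewritten under iterates of `arcDeriv`. -/
theorem arcDeriv_of_notMem (f : ℝ → E) {x : ℝ} (hx : x ∉ I) : arcDeriv c f x = 0 := by
  rw [arcDeriv, derivWithin_zero_of_notMem_closure, smul_zero]
  rwa [isClosed_Icc.closure_eq]

theorem arcDeriv_add {f g : ℝ → E} (hf : ContDiffOn ℝ ∞ f I) (hg : ContDiffOn ℝ ∞ g I) :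
    arcDeriv c (f + g) = arcDeriv c f + arcDeriv c g := by
  funext x
  by_cases hx : x ∈ I
  · simp only [Pi.add_apply, arcDeriv]
    rw [derivWithin_add (differentiableWithinAt_of_smooth hf hx)
      (differentiableWithinAt_of_smooth hg hx), smul_add]
  · simp [arcDeriv_of_notMem _ hx]

theorem arcDeriv_mul {f g : ℝ → ℝ} (hf : ContDiffOn ℝ ∞ f I) (hg : ContDiffOn ℝ ∞ g I) :
    arcDeriv c (f * g) = arcDeriv c f * g + f * arcDeriv c g := by
  funext x
  by_cases hx : x ∈ I
  · simp only [Pi.add_apply, Pi.mul_apply, arcDeriv, smul_eq_mul]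
    rw [derivWithin_mul (differentiableWithinAt_of_smooth hf hx)
      (differentiableWithinAt_of_smooth hg hx)]
    ring
  · simp [arcDeriv_of_notMem _ hx]

theorem arcDeriv_iterate_add (hc : ContDiffOn ℝ ∞ c I) (hr : IsRegular c) {f g : ℝ → E}
    (hf : ContDiffOn ℝ ∞ f I) (hg : ContDiffOn ℝ ∞ g I) (n : ℕ) :
    (arcDeriv c)^[n] (f + g) = (arcDeriv c)^[n] f + (arcDeriv c)^[n] g := by
  induction n with
  | zero => rfl
  | succ n ih =>
    simp only [Function.iterate_succ_apply']
    rw [ih, arcDeriv_add (contDiffOn_arcDeriv_iterate hc hr hf n)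
      (contDiffOn_arcDeriv_iterate hc hr hg n)]

theorem arcDeriv_iterate_succ_mul (hc : ContDiffOn ℝ ∞ c I) (hr : IsRegular c) {f g : ℝ → ℝ}
    (hf : ContDiffOn ℝ ∞ f I) (hg : ContDiffOn ℝ ∞ g I) (n : ℕ) :
    (arcDeriv c)^[n + 1] (f * g) =
      (arcDeriv c)^[n] (arcDeriv c f * g) + (arcDeriv c)^[n] (f * arcDeriv c g) := by
  rw [Function.iterate_succ_apply, arcDeriv_mul hf hg]
  exact arcDeriv_iterate_add hc hr ((contDiffOn_arcDeriv hc hr hf).mul hg)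
    (hf.mul (contDiffOn_arcDeriv hc hr hg)) n

end Calculus

/-! ### Integration along the curve -/

section Integral

variable {c : ℝ → Plane}

theorem arcDeriv_mul_speed (hr : IsRegular c) (f : ℝ → ℝ) {x : ℝ} (hx : x ∈ I) :
    arcDeriv c f x * speed c x = derivWithin f I x := by
  rw [arcDeriv, smul_eq_mul, mul_comm, mul_inv_cancel_left₀ (speed_pos hr hx).ne']

theorem uIcc_eq_I : uIcc (-1 : ℝ) 1 = I := uIcc_of_le (by norm_num)

theorem intervalIntegrable_arc (hc : ContDiffOn ℝ ∞ c I) (hr : IsRegular c) {f : ℝ → ℝ}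
    (hf : ContinuousOn f I) :
    IntervalIntegrable (fun x => f x * speed c x) volume (-1) 1 := by
  apply ContinuousOn.intervalIntegrable
  rw [uIcc_eq_I]
  exact hf.mul (contDiffOn_speed hc hr).continuousOn

theorem arcIntegral_add (hc : ContDiffOn ℝ ∞ c I) (hr : IsRegular c) {f g : ℝ → ℝ}
    (hf : ContinuousOn f I) (hg : ContinuousOn g I) :
    arcIntegral c (fun x => f x + g x) = arcIntegral c f + arcIntegral c g := by
  simp only [arcIntegral, add_mul]
  exact intervalIntegral.integral_add (intervalIntegrable_arc hc hr hf)
    (intervalIntegrable_arc hc hr hg)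

theorem arcIntegral_sub (hc : ContDiffOn ℝ ∞ c I) (hr : IsRegular c) {f g : ℝ → ℝ}
    (hf : ContinuousOn f I) (hg : ContinuousOn g I) :
    arcIntegral c (fun x => f x - g x) = arcIntegral c f - arcIntegral c g := by
  simp only [arcIntegral, sub_mul]
  exact intervalIntegral.integral_sub (intervalIntegrable_arc hc hr hf)
    (intervalIntegrable_arc hc hr hg)

theorem arcIntegral_const_mul (r : ℝ) (f : ℝ → ℝ) :
    arcIntegral c (fun x => r * f x) = r * arcIntegral c f := by
  simp only [arcIntegral, mul_assoc]
  exact intervalIntegral.integral_const_mul _ _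

theorem arcIntegral_sum (hc : ContDiffOn ℝ ∞ c I) (hr : IsRegular c) {ι : Type} (s : Finset ι)
    {f : ι → ℝ → ℝ} (hf : ∀ i ∈ s, ContinuousOn (f i) I) :
    arcIntegral c (fun x => ∑ i ∈ s, f i x) = ∑ i ∈ s, arcIntegral c (f i) := by
  simp only [arcIntegral, Finset.sum_mul]
  exact intervalIntegral.integral_finsetSum fun i hi => intervalIntegrable_arc hc hr (hf i hi)

theorem arcIntegral_congr {f g : ℝ → ℝ} (h : ∀ x ∈ I, f x = g x) :
    arcIntegral c f = arcIntegral c g := by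
  apply intervalIntegral.integral_congr
  intro x hx
  rw [uIcc_eq_I] at hx
  simp only [h x hx]

theorem arcIntegral_mono (hc : ContDiffOn ℝ ∞ c I) (hr : IsRegular c) {f g : ℝ → ℝ}
    (hf : ContinuousOn f I) (hg : ContinuousOn g I) (h : ∀ x ∈ I, f x ≤ g x) :
    arcIntegral c f ≤ arcIntegral c g :=
  intervalIntegral.integral_mono_on (by norm_num) (intervalIntegrable_arc hc hr hf)
    (intervalIntegrable_arc hc hr hg)
    fun x hx => mul_le_mul_of_nonneg_right (h x hx) (speed_nonneg x)

theorem arcIntegral_nonneg {f : ℝ → ℝ} (h : ∀ x ∈ I, 0 ≤ f x) : 0 ≤ arcIntegral c f :=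
  intervalIntegral.integral_nonneg (by norm_num) fun x hx => mul_nonneg (h x hx) (speed_nonneg x)

theorem arcIntegral_const (r : ℝ) : arcIntegral c (fun _ => r) = r * length c := by
  simpa [length] using arcIntegral_const_mul (c := c) r fun _ => 1

theorem abs_arcIntegral_le (hc : ContDiffOn ℝ ∞ c I) (hr : IsRegular c) {f : ℝ → ℝ} {B : ℝ}
    (hf : ContinuousOn f I) (h : ∀ x ∈ I, |f x| ≤ B) : |arcIntegral c f| ≤ B * length c := by
  rw [← arcIntegral_const]
  refine abs_le.2 ⟨?_, arcIntegral_mono hc hr hf continuousOn_const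
    fun x hx => (abs_le.1 (h x hx)).2⟩
  have := arcIntegral_mono hc hr (f := fun _ => -B) (g := f) continuousOn_const hf
    fun x hx => (abs_le.1 (h x hx)).1
  rw [arcIntegral_const] at this ⊢
  linarith

theorem length_pos (hc : ContDiffOn ℝ ∞ c I) (hr : IsRegular c) : 0 < length c := by
  have h := intervalIntegrable_arc hc hr (f := fun _ => 1) continuousOn_const
  exact intervalIntegral.intervalIntegral_pos_of_pos_on h
    (fun x hx => by simpa using speed_pos hr (Ioo_subset_Icc_self hx)) (by norm_num)

/-- The end points may come in either order, as needed when integrating from a zero of unknown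
position. -/
theorem arcIntegral_arcDeriv_subinterval (hr : IsRegular c) {f : ℝ → ℝ}
    (hf : ContDiffOn ℝ ∞ f I) {a b : ℝ} (ha : a ∈ I) (hb : b ∈ I) :
    ∫ x in a..b, arcDeriv c f x * speed c x = f b - f a := by
  have hsub : uIcc a b ⊆ I := ordConnected_Icc.uIcc_subset ha hb
  have hcongr : ∫ x in a..b, arcDeriv c f x * speed c x = ∫ x in a..b, derivWithin f I x :=
    intervalIntegral.integral_congr fun x hx => arcDeriv_mul_speed hr f (hsub hx)
  rw [hcongr]
  refine intervalIntegral.integral_eq_sub_of_hasDeriv_right (hf.continuousOn.mono hsub) ?_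
    (((contDiffOn_derivWithin hf).continuousOn.mono hsub).intervalIntegrable)
  intro x hx
  have hxI : x ∈ Ioo (-1 : ℝ) 1 :=
    ⟨(le_min ha.1 hb.1).trans_lt hx.1, hx.2.trans_le (max_le ha.2 hb.2)⟩
  exact ((differentiableWithinAt_of_smooth hf (Ioo_subset_Icc_self hxI)).hasDerivWithinAt.hasDerivAt
    (Icc_mem_nhds hxI.1 hxI.2)).hasDerivWithinAt

theorem arcIntegral_arcDeriv (hr : IsRegular c) {f : ℝ → ℝ} (hf : ContDiffOn ℝ ∞ f I) :
    arcIntegral c (arcDeriv c f) = f 1 - f (-1) :=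
  arcIntegral_arcDeriv_subinterval hr hf left_mem_I right_mem_I

theorem arcIntegral_mul_arcDeriv (hc : ContDiffOn ℝ ∞ c I) (hr : IsRegular c) {f g : ℝ → ℝ}
    (hf : ContDiffOn ℝ ∞ f I) (hg : ContDiffOn ℝ ∞ g I) :
    arcIntegral c (f * arcDeriv c g) =
      f 1 * g 1 - f (-1) * g (-1) - arcIntegral c (arcDeriv c f * g) := by
  have h := arcIntegral_arcDeriv hr (hf.mul hg)
  change arcIntegral c (arcDeriv c (f * g)) = _ at h
  rw [arcDeriv_mul hf hg] at h
  have h2 := arcIntegral_add hc hr (f := arcDeriv c f * g) (g := f * arcDeriv c g)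
    ((contDiffOn_arcDeriv hc hr hf).mul hg).continuousOn
    (hf.mul (contDiffOn_arcDeriv hc hr hg)).continuousOn
  change arcIntegral c (arcDeriv c f * g + f * arcDeriv c g) = _ at h2
  linarith

/-- The Cauchy–Schwarz inequality for `∫ f g ds`. -/
theorem arcIntegral_mul_sq_le (hc : ContDiffOn ℝ ∞ c I) (hr : IsRegular c) {f g : ℝ → ℝ}
    (hf : ContinuousOn f I) (hg : ContinuousOn g I) :
    arcIntegral c (fun x => f x * g x) ^ 2 ≤
      arcIntegral c (fun x => f x ^ 2) * arcIntegral c (fun x => g x ^ 2) := by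
  have key : ∀ r : ℝ, 0 ≤ arcIntegral c (fun x => f x ^ 2) * (r * r)
      + 2 * arcIntegral c (fun x => f x * g x) * r + arcIntegral c (fun x => g x ^ 2) := by
    intro r
    have h0 : 0 ≤ arcIntegral c (fun x => (r * r) * f x ^ 2 + (2 * r) * (f x * g x) + g x ^ 2) :=
      arcIntegral_nonneg fun x _ => by nlinarith [sq_nonneg (r * f x + g x)]
    rw [arcIntegral_add hc hr (f := fun x => (r * r) * f x ^ 2 + (2 * r) * (f x * g x))
      (by fun_prop) (by fun_prop), arcIntegral_add hc hr (by fun_prop) (by fun_prop),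
      arcIntegral_const_mul, arcIntegral_const_mul] at h0
    linarith
  have h := discrim_le_zero key
  rw [discrim] at h
  nlinarith

end Integral

/-! ### Parity at the end points, derivative bounds, repeated integration by parts -/

section Classes

variable {c : ℝ → Plane}

/-- `f` has parity `p` at the end points to order `n`: of its first `n` arclength derivatives,
those of order `i` with `i + p` odd vanish at both end points. -/
def HasParity (c : ℝ → Plane) (p n : ℕ) (f : ℝ → ℝ) : Prop :=
  ∀ i < n, Odd (i + p) → (arcDeriv c)^[i] f (-1) = 0 ∧ (arcDeriv c)^[i] f 1 = 0

theorem HasParity.mono {p n n' : ℕ} {f : ℝ → ℝ} (h : HasParity c p n f) (hn : n' ≤ n) :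
    HasParity c p n' f := fun i hi => h i (hi.trans_le hn)

theorem HasParity.arcDeriv {p n : ℕ} {f : ℝ → ℝ} (h : HasParity c p (n + 1) f) :
    HasParity c (p + 1) n (arcDeriv c f) := fun i hi hodd => by
  rw [← Function.iterate_succ_apply]
  exact h (i + 1) (by omega) (by convert hodd using 1; omega)

/-- In the Leibniz expansion of a derivative whose order plus p + q is odd, every term has a factor
of the wrong parity, which vanishes. The induction differentiates once and treats the two resulting
products separately. -/
theorem HasParity.mul (hc : ContDiffOn ℝ ∞ c I) (hr : IsRegular c) {n p q : ℕ} {f g : ℝ → ℝ}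
    (hf : ContDiffOn ℝ ∞ f I) (hg : ContDiffOn ℝ ∞ g I)
    (hpf : HasParity c p n f) (hqg : HasParity c q n g) : HasParity c (p + q) n (f * g) := by
  induction n generalizing p q f g with
  | zero => intro i hi; omega
  | succ n ih =>
    intro i hi hodd
    cases i with
    | zero =>
      simp only [Function.iterate_zero, id_eq, Pi.mul_apply]
      rcases Nat.even_or_odd p with hp | hp
      · have hq : Odd (0 + q) := by
          rw [Nat.odd_iff] at *; rw [Nat.even_iff] at hp; omega
        obtain ⟨h1, h2⟩ := hqg 0 (by omega) hq
        simp only [Function.iterate_zero, id_eq] at h1 h2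
        simp [h1, h2]
      · obtain ⟨h1, h2⟩ := hpf 0 (by omega) (by simpa using hp)
        simp only [Function.iterate_zero, id_eq] at h1 h2
        simp [h1, h2]
    | succ i =>
      rw [arcDeriv_iterate_succ_mul hc hr hf hg]
      have h1 := ih (contDiffOn_arcDeriv hc hr hf) hg hpf.arcDeriv (hqg.mono (Nat.le_succ n)) i
        (by omega) (by convert hodd using 1; omega)
      have h2 := ih hf (contDiffOn_arcDeriv hc hr hg) (hpf.mono (Nat.le_succ n)) hqg.arcDeriv i
        (by omega) (by convert hodd using 1; omega)
      simp [h1.1, h1.2, h2.1, h2.2]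

/-- The arclength derivatives of `f` of order `i ≤ n` are bounded by `A * ρ ^ i`. -/
def DerivBound (c : ℝ → Plane) (A ρ : ℝ) (n : ℕ) (f : ℝ → ℝ) : Prop :=
  ∀ i ≤ n, ∀ x ∈ I, |(arcDeriv c)^[i] f x| ≤ A * ρ ^ i

theorem DerivBound.mono {A ρ : ℝ} {n n' : ℕ} {f : ℝ → ℝ} (h : DerivBound c A ρ n f)
    (hn : n' ≤ n) : DerivBound c A ρ n' f := fun i hi => h i (hi.trans hn)

theorem DerivBound.arcDeriv {A ρ : ℝ} {n : ℕ} {f : ℝ → ℝ} (h : DerivBound c A ρ (n + 1) f) :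
    DerivBound c (A * ρ) ρ n (arcDeriv c f) := fun i hi x hx => by
  rw [← Function.iterate_succ_apply]
  exact (h (i + 1) (by omega) x hx).trans_eq (by ring)

/-- The Leibniz sum of geometric bounds is a binomial expansion, so ratios add under products. A
product of n curvature derivatives thus has ratio nρ, the source of the powers of 3 and 5 below. -/
theorem DerivBound.mul (hc : ContDiffOn ℝ ∞ c I) (hr : IsRegular c) {n : ℕ} {A B ρ σ : ℝ}
    {f g : ℝ → ℝ} (hf : ContDiffOn ℝ ∞ f I) (hg : ContDiffOn ℝ ∞ g I)
    (hbf : DerivBound c A ρ n f) (hbg : DerivBound c B σ n g) :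
    DerivBound c (A * B) (ρ + σ) n (f * g) := by
  induction n generalizing A B f g with
  | zero =>
    intro i hi x hx
    obtain rfl : i = 0 := by omega
    have h1 := hbf 0 le_rfl x hx
    have h2 := hbg 0 le_rfl x hx
    simp only [Function.iterate_zero, id_eq, pow_zero, mul_one, Pi.mul_apply, abs_mul] at *
    exact mul_le_mul h1 h2 (abs_nonneg _) ((abs_nonneg _).trans h1)
  | succ n ih =>
    intro i hi x hx
    cases i with
    | zero =>
      have h1 := hbf 0 (by omega) x hx
      have h2 := hbg 0 (by omega) x hx
      simp only [Function.iterate_zero, id_eq, pow_zero, mul_one, Pi.mul_apply, abs_mul] at *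
      exact mul_le_mul h1 h2 (abs_nonneg _) ((abs_nonneg _).trans h1)
    | succ i =>
      rw [arcDeriv_iterate_succ_mul hc hr hf hg]
      have h1 := ih (contDiffOn_arcDeriv hc hr hf) hg hbf.arcDeriv (hbg.mono (Nat.le_succ n)) i
        (by omega) x hx
      have h2 := ih hf (contDiffOn_arcDeriv hc hr hg) (hbf.mono (Nat.le_succ n)) hbg.arcDeriv i
        (by omega) x hx
      refine (abs_add_le _ _).trans ((add_le_add h1 h2).trans_eq ?_)
      ring

/-- Repeated integration by parts, where the boundary terms vanish by parity. -/
theorem arcIntegral_mul_arcDeriv_iterate (hc : ContDiffOn ℝ ∞ c I) (hr : IsRegular c)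
    {f g : ℝ → ℝ} (hf : ContDiffOn ℝ ∞ f I) (hg : ContDiffOn ℝ ∞ g I) {p q j : ℕ}
    (hpf : HasParity c p j f) (hqg : HasParity c q j g) (hpq : Even (p + q + j)) :
    arcIntegral c (f * (arcDeriv c)^[j] g) = (-1) ^ j * arcIntegral c ((arcDeriv c)^[j] f * g) := by
  induction j generalizing p f with
  | zero => simp
  | succ j ih =>
    have hgj := contDiffOn_arcDeriv_iterate hc hr hg j
    rw [Function.iterate_succ_apply', arcIntegral_mul_arcDeriv hc hr hf hgj,
      ih (contDiffOn_arcDeriv hc hr hf) hpf.arcDeriv (hqg.mono (Nat.le_succ j))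
        (by convert hpq using 1; omega), Function.iterate_succ_apply]
    -- The numbers p and j + q have odd sum, so one of the two factors vanishes at both ends.
    have hb : f 1 * (arcDeriv c)^[j] g 1 = 0 ∧ f (-1) * (arcDeriv c)^[j] g (-1) = 0 := by
      rcases Nat.even_or_odd p with hp | hp
      · have hq : Odd (j + q) := by
          rw [Nat.odd_iff]; rw [Nat.even_iff] at hp hpq; omega
        obtain ⟨h1, h2⟩ := hqg j (by omega) hq
        simp [h1, h2]
      · obtain ⟨h1, h2⟩ := hpf 0 (by omega) (by simpa using hp)
        simp only [Function.iterate_zero, id_eq] at h1 h2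
        simp [h1, h2]
    rw [hb.1, hb.2]
    ring

end Classes

/-! ### Zeros, Poincaré inequalities and log-convexity for the curvature -/

section Curvature

variable {c : ℝ → Plane}

theorem contDiffOn_rot {F : Type} [NormedAddCommGroup F] [NormedSpace ℝ F] {s : Set F}
    {n : WithTop ℕ∞} {f : F → Plane} (hf : ContDiffOn ℝ n f s) :
    ContDiffOn ℝ n (fun x => rot (f x)) s := by
  rw [contDiffOn_euclidean] at hf ⊢
  intro i
  fin_cases i
  · simpa [rot] using (hf 1).neg
  · simpa [rot] using hf 0

theorem contDiffOn_curvature (hc : ContDiffOn ℝ ∞ c I) (hr : IsRegular c) :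
    ContDiffOn ℝ ∞ (curvature c) I := by
  have ht : ContDiffOn ℝ ∞ (tangent c) I := contDiffOn_arcDeriv hc hr hc
  exact (contDiffOn_arcDeriv hc hr ht).inner ℝ (contDiffOn_rot ht)

theorem contDiffOn_curvatureDeriv (hc : ContDiffOn ℝ ∞ c I) (hr : IsRegular c) (j : ℕ) :
    ContDiffOn ℝ ∞ (curvatureDeriv c j) I :=
  contDiffOn_arcDeriv_iterate hc hr (contDiffOn_curvature hc hr) j

theorem arcDeriv_iterate_curvatureDeriv (i j : ℕ) :
    (arcDeriv c)^[i] (curvatureDeriv c j) = curvatureDeriv c (j + i) := by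
  rw [curvatureDeriv, curvatureDeriv, ← Function.iterate_add_apply, add_comm]

theorem arcDeriv_curvatureDeriv (j : ℕ) :
    arcDeriv c (curvatureDeriv c j) = curvatureDeriv c (j + 1) :=
  arcDeriv_iterate_curvatureDeriv 1 j

/-- The properties of the curvature of a curve between parallel lines that the estimates use. -/
structure BalancedCurve (m : ℕ) (c : ℝ → Plane) : Prop where
  smooth : ContDiffOn ℝ ∞ c I
  regular : IsRegular c
  odd_deriv : ∀ x ∈ ({-1, 1} : Set ℝ), ∀ l ≤ m, curvatureDeriv c (2 * l + 1) x = 0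
  integral_curvature : arcIntegral c (curvature c) = 0

/-- The norm of `k_{s^j}` in `L²(ds)`. -/
noncomputable def curvatureNorm (c : ℝ → Plane) (j : ℕ) : ℝ := √(energy j c)

variable {m : ℕ}

theorem curvatureNorm_nonneg (j : ℕ) : 0 ≤ curvatureNorm c j := Real.sqrt_nonneg _

theorem energy_nonneg (j : ℕ) : 0 ≤ energy j c := arcIntegral_nonneg fun _ _ => sq_nonneg _

theorem curvatureNorm_sq (j : ℕ) : curvatureNorm c j ^ 2 = energy j c :=
  Real.sq_sqrt (energy_nonneg j)

namespace BalancedCurve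

theorem contDiffOn_curvatureDeriv (h : BalancedCurve m c) (j : ℕ) :
    ContDiffOn ℝ ∞ (curvatureDeriv c j) I :=
  CurveFlow.contDiffOn_curvatureDeriv h.smooth h.regular j

/-- The range 2m + 2 - a is exactly what the boundary conditions give: odd derivatives of k vanish
up to order 2m + 1. -/
theorem hasParity (h : BalancedCurve m c) (a : ℕ) :
    HasParity c a (2 * m + 2 - a) (curvatureDeriv c a) := by
  intro i hi hodd
  rw [arcDeriv_iterate_curvatureDeriv, add_comm a i]
  obtain ⟨l, hl⟩ := hodd
  rw [hl]
  exact ⟨h.odd_deriv _ (by simp) l (by omega), h.odd_deriv _ (by simp) l (by omega)⟩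

theorem eq_zero_of_odd (h : BalancedCurve m c) {j : ℕ} (hj : Odd j) (hjm : j ≤ 2 * m + 1) :
    curvatureDeriv c j (-1) = 0 ∧ curvatureDeriv c j 1 = 0 := by
  obtain ⟨l, rfl⟩ := hj
  exact ⟨h.odd_deriv _ (by simp) l (by omega), h.odd_deriv _ (by simp) l (by omega)⟩

theorem arcIntegral_curvatureDeriv_eq_zero (h : BalancedCurve m c) {j : ℕ} (hj : Even j)
    (hjm : j ≤ 2 * m + 2) : arcIntegral c (curvatureDeriv c j) = 0 := by
  rcases j with _ | j
  · exact h.integral_curvature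
  · rw [← arcDeriv_curvatureDeriv, arcIntegral_arcDeriv h.regular (h.contDiffOn_curvatureDeriv j)]
    have := h.eq_zero_of_odd (j := j) (by rw [Nat.odd_iff]; rw [Nat.even_iff] at hj; omega)
      (by omega)
    rw [this.1, this.2, sub_zero]

/-- For even j a continuous function of constant sign could not have zero integral; for odd j an end
point serves. -/
theorem exists_zero (h : BalancedCurve m c) {j : ℕ} (hjm : j ≤ 2 * m + 2) :
    ∃ z ∈ I, curvatureDeriv c j z = 0 := by
  rcases Nat.even_or_odd j with hj | hj
  · by_contra! hne
    have hcont := (h.contDiffOn_curvatureDeriv j).continuousOn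
    have hint := h.arcIntegral_curvatureDeriv_eq_zero hj hjm
    have hii := intervalIntegrable_arc h.smooth h.regular hcont
    rcases lt_or_gt_of_ne (hne _ left_mem_I) with h0 | h0
    · have hneg : ∀ x ∈ I, curvatureDeriv c j x < 0 := by
        intro x hx
        by_contra! hx0
        obtain ⟨z, hz, hz0⟩ := intermediate_value_Icc hx.1
          (hcont.mono (Icc_subset_Icc_right hx.2)) ⟨h0.le, hx0⟩
        exact hne z ⟨hz.1, hz.2.trans hx.2⟩ hz0
      have := intervalIntegral.intervalIntegral_pos_of_pos_on hii.neg
        (fun x hx => by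
          have hxI := Ioo_subset_Icc_self hx
          simpa using mul_neg_of_neg_of_pos (hneg x hxI) (speed_pos h.regular hxI)) (by norm_num)
      have h2 : ∫ x in (-1 : ℝ)..1, (-fun x => curvatureDeriv c j x * speed c x) x
          = -arcIntegral c (curvatureDeriv c j) := intervalIntegral.integral_neg
      rw [h2, hint] at this
      simp at this
    · have hpos : ∀ x ∈ I, 0 < curvatureDeriv c j x := by
        intro x hx
        by_contra! hx0
        obtain ⟨z, hz, hz0⟩ := intermediate_value_Icc' hx.1
          (hcont.mono (Icc_subset_Icc_right hx.2)) ⟨hx0, h0.le⟩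
        exact hne z ⟨hz.1, hz.2.trans hx.2⟩ hz0
      have := intervalIntegral.intervalIntegral_pos_of_pos_on hii
        (fun x hx => by
          have hxI := Ioo_subset_Icc_self hx
          exact mul_pos (hpos x hxI) (speed_pos h.regular hxI)) (by norm_num)
      exact this.ne' hint
  · by_cases hjm' : j ≤ 2 * m + 1
    · exact ⟨-1, left_mem_I, (h.eq_zero_of_odd hj hjm').1⟩
    · rw [Nat.odd_iff] at hj; omega

theorem arcIntegral_abs_mul_le (h : BalancedCurve m c) (i j : ℕ) :
    arcIntegral c (fun x => |curvatureDeriv c i x| * |curvatureDeriv c j x|) ≤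
      curvatureNorm c i * curvatureNorm c j := by
  have hi := (h.contDiffOn_curvatureDeriv i).continuousOn
  have hj := (h.contDiffOn_curvatureDeriv j).continuousOn
  have := arcIntegral_mul_sq_le h.smooth h.regular hi.abs hj.abs
  simp only [sq_abs] at this
  change _ ≤ energy i c * energy j c at this
  rw [← curvatureNorm_sq, ← curvatureNorm_sq, ← mul_pow] at this
  exact le_of_sq_le_sq this (mul_nonneg (curvatureNorm_nonneg i) (curvatureNorm_nonneg j))

/-- Integrate (k_{s^j}²)_s from a zero to x and apply Cauchy–Schwarz. -/
theorem curvatureDeriv_sq_le (h : BalancedCurve m c) {j : ℕ} (hjm : j ≤ 2 * m + 2) {x : ℝ}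
    (hx : x ∈ I) :
    curvatureDeriv c j x ^ 2 ≤ 2 * (curvatureNorm c j * curvatureNorm c (j + 1)) := by
  obtain ⟨z, hz, hz0⟩ := h.exists_zero hjm
  have hj := h.contDiffOn_curvatureDeriv j
  have hj1 := h.contDiffOn_curvatureDeriv (j + 1)
  have heq := arcIntegral_arcDeriv_subinterval h.regular (hj.mul hj) hz hx
  change ∫ y in z..x, arcDeriv c (curvatureDeriv c j * curvatureDeriv c j) y * speed c y = _ at heq
  rw [arcDeriv_mul hj hj, arcDeriv_curvatureDeriv, hz0] at heq
  have hle := intervalIntegral.norm_integral_le_integral_norm_uIoc (a := z) (b := x)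
    (μ := volume) (f := fun y => (curvatureDeriv c (j + 1) * curvatureDeriv c j
      + curvatureDeriv c j * curvatureDeriv c (j + 1)) y * speed c y)
  rw [heq] at hle
  have hcont : ContinuousOn (fun y => |curvatureDeriv c j y| * |curvatureDeriv c (j + 1) y|) I :=
    hj.continuousOn.abs.mul hj1.continuousOn.abs
  -- Working on the unoriented interval covers both positions of z relative to x; the integrand is
  -- nonnegative, so the domain can be enlarged to the whole curve.
  have hmono : ∫ y in Set.uIoc z x, ‖(curvatureDeriv c (j + 1) * curvatureDeriv c j
      + curvatureDeriv c j * curvatureDeriv c (j + 1)) y * speed c y‖ ≤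
      2 * arcIntegral c (fun y => |curvatureDeriv c j y| * |curvatureDeriv c (j + 1) y|) := by
    rw [← arcIntegral_const_mul, arcIntegral, intervalIntegral.integral_of_le (by norm_num)]
    have hfun : (fun y => ‖(curvatureDeriv c (j + 1) * curvatureDeriv c j
        + curvatureDeriv c j * curvatureDeriv c (j + 1)) y * speed c y‖) = fun y =>
        2 * (|curvatureDeriv c j y| * |curvatureDeriv c (j + 1) y|) * speed c y := by
      funext y
      simp only [Pi.add_apply, Pi.mul_apply, norm_mul, Real.norm_eq_abs,
        abs_of_nonneg (speed_nonneg (c := c) y)]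
      rw [mul_comm (curvatureDeriv c (j + 1) y), ← two_mul, abs_mul, abs_mul, abs_two]
    rw [hfun]
    refine setIntegral_mono_set ?_ (Filter.Eventually.of_forall fun y => ?_) ?_
    · exact (intervalIntegrable_iff_integrableOn_Ioc_of_le (by norm_num)).1
        (intervalIntegrable_arc h.smooth h.regular (hcont.const_smul (2 : ℝ)))
    · have := speed_nonneg (c := c) y
      simp only [Pi.zero_apply]
      positivity
    · have hsub : Set.uIoc z x ⊆ Ioc (-1 : ℝ) 1 := fun y hy =>
        ⟨(le_min hz.1 hx.1).trans_lt hy.1, hy.2.trans (max_le hz.2 hx.2)⟩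
      exact hsub.eventuallyLE
  have h4 := h.arcIntegral_abs_mul_le j (j + 1)
  have h5 : curvatureDeriv c j x ^ 2 =
      ‖curvatureDeriv c j x * curvatureDeriv c j x - 0 * 0‖ := by
    simp only [mul_zero, sub_zero, Real.norm_eq_abs, abs_mul_abs_self, abs_mul]
    ring
  rw [h5]
  linarith

/-- Integrating the pointwise bound gives a_j² ≤ 2L a_j a_{j+1}; then divide by a_j. -/
theorem curvatureNorm_le (h : BalancedCurve m c) {j : ℕ} (hjm : j ≤ 2 * m + 2) :
    curvatureNorm c j ≤ 2 * length c * curvatureNorm c (j + 1) := by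
  have hL := length_pos h.smooth h.regular
  have h1 := arcIntegral_mono h.smooth h.regular
    ((h.contDiffOn_curvatureDeriv j).continuousOn.pow 2) continuousOn_const
    fun x hx => h.curvatureDeriv_sq_le hjm hx
  rw [arcIntegral_const] at h1
  change energy j c ≤ _ at h1
  rw [← curvatureNorm_sq] at h1
  rcases (curvatureNorm_nonneg (c := c) j).eq_or_lt with h0 | h0
  · rw [← h0]
    have := curvatureNorm_nonneg (c := c) (j + 1)
    positivity
  · have : curvatureNorm c j * curvatureNorm c j ≤
        curvatureNorm c j * (2 * length c * curvatureNorm c (j + 1)) := by linarith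
    exact le_of_mul_le_mul_left this h0

theorem curvatureNorm_le_pow (h : BalancedCurve m c) {n : ℕ} (hn : n ≤ 2 * m + 3) :
    curvatureNorm c 0 ≤ (2 * length c) ^ n * curvatureNorm c n := by
  have hL := length_pos h.smooth h.regular
  induction n with
  | zero => simp
  | succ n ih =>
    refine (ih (by omega)).trans ?_
    rw [pow_succ, mul_assoc]
    exact mul_le_mul_of_nonneg_left (h.curvatureNorm_le (by omega)) (by positivity)

/-- One integration by parts and Cauchy–Schwarz; the boundary term vanishes because one of i, i + 1
is odd. -/
theorem curvatureNorm_sq_le_mul (h : BalancedCurve m c) {i : ℕ} (him : i + 1 ≤ 2 * m + 2) :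
    curvatureNorm c (i + 1) ^ 2 ≤ curvatureNorm c i * curvatureNorm c (i + 2) := by
  have hi := h.contDiffOn_curvatureDeriv i
  have hi1 := h.contDiffOn_curvatureDeriv (i + 1)
  have hi2 := h.contDiffOn_curvatureDeriv (i + 2)
  have hibp := arcIntegral_mul_arcDeriv h.smooth h.regular hi1 hi
  rw [arcDeriv_curvatureDeriv, arcDeriv_curvatureDeriv] at hibp
  have hb : curvatureDeriv c (i + 1) 1 * curvatureDeriv c i 1 = 0 ∧
      curvatureDeriv c (i + 1) (-1) * curvatureDeriv c i (-1) = 0 := by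
    rcases Nat.even_or_odd i with he | ho
    · have := h.eq_zero_of_odd (j := i + 1) he.add_one (by rw [Nat.even_iff] at he; omega)
      simp [this.1, this.2]
    · have := h.eq_zero_of_odd ho (by omega)
      simp [this.1, this.2]
  rw [hb.1, hb.2] at hibp
  have h1 : arcIntegral c (curvatureDeriv c (i + 1) * curvatureDeriv c (i + 1)) =
      curvatureNorm c (i + 1) ^ 2 := by
    rw [curvatureNorm_sq]
    exact arcIntegral_congr fun x _ => by simp [sq]
  have h2 : arcIntegral c (fun x => -(curvatureDeriv c (i + 1 + 1) * curvatureDeriv c i) x) ≤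
      arcIntegral c (fun x => |curvatureDeriv c i x| * |curvatureDeriv c (i + 2) x|) :=
    arcIntegral_mono h.smooth h.regular (hi2.mul hi).continuousOn.neg
      (hi.continuousOn.abs.mul hi2.continuousOn.abs) fun x _ => by
        rw [← abs_mul, mul_comm (curvatureDeriv c i x)]
        exact neg_le_abs _
  have h3 : arcIntegral c (fun x => -(curvatureDeriv c (i + 1 + 1) * curvatureDeriv c i) x) =
      -arcIntegral c (curvatureDeriv c (i + 1 + 1) * curvatureDeriv c i) := by
    have := arcIntegral_const_mul (c := c) (-1) (curvatureDeriv c (i + 1 + 1) * curvatureDeriv c i)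
    simpa using this
  have h4 := h.arcIntegral_abs_mul_le i (i + 2)
  linarith

end BalancedCurve

end Curvature

/-- A finite sequence of nonnegative numbers with `b (i + 1) ^ 2 ≤ b i * b (i + 2)` is bounded by
the larger one of its end values. -/
theorem le_of_sq_le_mul {b : ℕ → ℝ} {N : ℕ} {B : ℝ} (hb : ∀ i, 0 ≤ b i)
    (hconv : ∀ i, i + 2 ≤ N → b (i + 1) ^ 2 ≤ b i * b (i + 2)) (h0 : b 0 ≤ B) (hN : b N ≤ B)
    {i : ℕ} (hi : i ≤ N) : b i ≤ B := by
  by_contra! hlt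
  obtain ⟨p, hp, hmax⟩ := Finset.exists_max_image (Finset.range (N + 1)) b ⟨0, by simp⟩
  have hBp : B < b p := hlt.trans_le (hmax i (by simp; omega))
  -- Take the first index where the maximum is attained. It is interior and its left neighbour is
  -- strictly smaller, contradicting log-convexity.
  have hex : ∃ q, q ≤ N ∧ b q = b p := ⟨p, by simp at hp; omega, rfl⟩
  classical
  obtain ⟨hqN, hqp⟩ := Nat.find_spec hex
  have hmin := fun r (hr : r < Nat.find hex) => Nat.find_min hex hr
  set q := Nat.find hex
  rcases q with _ | q
  · linarith
  have hq1 : q + 1 ≠ N := by rintro rfl; linarith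
  have hlt' : b q < b p :=
    lt_of_le_of_ne (hmax q (by simp; omega)) fun he => hmin q (Nat.lt_succ_self q) ⟨by omega, he⟩
  have hle' : b (q + 2) ≤ b p := hmax (q + 2) (by simp; omega)
  have hc := hconv q (by omega)
  rw [hqp] at hc
  have hpos : 0 < b p := (hb q).trans_lt hlt'
  nlinarith [hb q, hb (q + 2)]

/-! ### Interpolation and bounds for products of curvature derivatives -/

namespace BalancedCurve

variable {c : ℝ → Plane} {m : ℕ}

theorem curvatureNorm_eq_zero (h : BalancedCurve m c) (h0 : curvatureNorm c 0 = 0) {i : ℕ}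
    (hi : i ≤ 2 * m + 2) : curvatureNorm c i = 0 := by
  rcases i with _ | i
  · exact h0
  induction i with
  | zero =>
    have := h.curvatureNorm_sq_le_mul (i := 0) (by omega)
    rw [h0, zero_mul] at this
    exact pow_eq_zero_iff two_ne_zero |>.1 (le_antisymm this (sq_nonneg _))
  | succ i ih =>
    have := h.curvatureNorm_sq_le_mul (i := i + 1) (by omega)
    rw [ih (by omega), zero_mul] at this
    exact pow_eq_zero_iff two_ne_zero |>.1 (le_antisymm this (sq_nonneg _))

/-- Interpolation: the norms of the derivatives of the curvature up to order `N` grow at most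
geometrically, with a ratio for which equality holds at order `N`. -/
theorem exists_ratio (h : BalancedCurve m c) {N : ℕ} (hN : 1 ≤ N) (hNm : N ≤ 2 * m + 2) :
    ∃ ρ : ℝ, 0 < ρ ∧ 1 ≤ 2 * length c * ρ ∧
      (∀ i ≤ N, curvatureNorm c i ≤ curvatureNorm c 0 * ρ ^ i) ∧
      curvatureNorm c N = curvatureNorm c 0 * ρ ^ N := by
  have hL := length_pos h.smooth h.regular
  have hN0 : N ≠ 0 := by omega
  rcases (curvatureNorm_nonneg (c := c) 0).eq_or_lt with h0 | h0
  -- If k vanishes in L², all the norms involved are zero, and ρ is chosen only to satisfy 2Lρ ≥ 1.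
  · refine ⟨(2 * length c)⁻¹, by positivity, by rw [mul_inv_cancel₀ (by positivity)],
      fun i hi => ?_, ?_⟩
    · rw [h.curvatureNorm_eq_zero h0.symm (by omega), ← h0, zero_mul]
    · rw [h.curvatureNorm_eq_zero h0.symm (by omega), ← h0, zero_mul]
  · have hle := h.curvatureNorm_le_pow (n := N) (by omega)
    -- This ρ forces equality at order N, and the iterated Poincaré inequality says precisely that
    -- 2Lρ ≥ 1.
    set ρ : ℝ := (curvatureNorm c N / curvatureNorm c 0) ^ ((N : ℝ)⁻¹) with hρ
    have hq : 0 ≤ curvatureNorm c N / curvatureNorm c 0 := div_nonneg (curvatureNorm_nonneg N) h0.le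
    have hρN : ρ ^ N = curvatureNorm c N / curvatureNorm c 0 := Real.rpow_inv_natCast_pow hq hN0
    have hρ0 : 0 ≤ ρ := Real.rpow_nonneg hq _
    have hNpos : 0 < curvatureNorm c N := by
      by_contra! hneg
      have : curvatureNorm c N = 0 := le_antisymm hneg (curvatureNorm_nonneg N)
      rw [this, mul_zero] at hle
      linarith
    have hρpos : 0 < ρ := Real.rpow_pos_of_pos (div_pos hNpos h0) _
    have heq : curvatureNorm c N = curvatureNorm c 0 * ρ ^ N := by
      rw [hρN]; field_simp
    refine ⟨ρ, hρpos, ?_, fun i hi => ?_, heq⟩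
    · rw [heq] at hle
      have h1 : (1 : ℝ) ^ N ≤ (2 * length c * ρ) ^ N := by
        rw [one_pow, mul_pow]
        have : curvatureNorm c 0 * 1 ≤ curvatureNorm c 0 * ((2 * length c) ^ N * ρ ^ N) := by
          linarith
        exact le_of_mul_le_mul_left this h0
      exact le_of_pow_le_pow_left₀ hN0 (by positivity) h1
    -- Dividing by ρ^i preserves log-convexity and makes both end values equal to a_0.
    · have key := le_of_sq_le_mul (b := fun i => curvatureNorm c i / ρ ^ i) (N := N)
        (B := curvatureNorm c 0) (fun i => div_nonneg (curvatureNorm_nonneg i) (by positivity))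
        (fun i hi => by
          have := h.curvatureNorm_sq_le_mul (i := i) (by omega)
          rw [div_pow, div_mul_div_comm, ← pow_mul, ← pow_add,
            show (i + 1) * 2 = i + (i + 2) by ring]
          exact div_le_div_of_nonneg_right this (by positivity))
        (by simp) (by rw [heq, mul_div_cancel_right₀ _ (by positivity)]) hi
      exact (div_le_iff₀ (by positivity)).1 key

/-- The pointwise bounds that follow from interpolation. -/
theorem abs_curvatureDeriv_le (h : BalancedCurve m c) {N : ℕ} (hNm : N ≤ 2 * m + 2) {ρ : ℝ}
    (hρ : 0 < ρ) (hle : ∀ i ≤ N, curvatureNorm c i ≤ curvatureNorm c 0 * ρ ^ i) {i : ℕ}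
    (hi : i < N) {x : ℝ} (hx : x ∈ I) :
    |curvatureDeriv c i x| ≤ √(2 * curvatureNorm c 0 ^ 2 * ρ) * ρ ^ i := by
  have h0 := curvatureNorm_nonneg (c := c) 0
  refine abs_le_of_sq_le_sq ?_ (by positivity)
  rw [mul_pow, Real.sq_sqrt (by positivity)]
  refine (h.curvatureDeriv_sq_le (by omega) hx).trans ?_
  have := mul_le_mul (hle i hi.le) (hle (i + 1) hi) (curvatureNorm_nonneg _)
    (by positivity)
  calc 2 * (curvatureNorm c i * curvatureNorm c (i + 1)) ≤
      2 * (curvatureNorm c 0 * ρ ^ i * (curvatureNorm c 0 * ρ ^ (i + 1))) := by linarith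
    _ = _ := by ring

theorem derivBound_curvatureDeriv {A ρ : ℝ} {n : ℕ}
    (hA : ∀ i ≤ n, ∀ x ∈ I, |curvatureDeriv c i x| ≤ A * ρ ^ i) {a j : ℕ} (haj : a + j ≤ n) :
    DerivBound c (A * ρ ^ a) ρ j (curvatureDeriv c a) := by
  intro i hi x hx
  rw [arcDeriv_iterate_curvatureDeriv]
  exact (hA (a + i) (by omega) x hx).trans_eq (by rw [pow_add, mul_assoc])

/-- A product of a function with a derivative of the curvature, estimated after moving `j`
derivatives. -/
theorem abs_arcIntegral_mul_le (h : BalancedCurve m c) {A B σ ρ : ℝ} {n : ℕ}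
    (hB : ∀ i ≤ n, ∀ x ∈ I, |curvatureDeriv c i x| ≤ B * ρ ^ i) {f : ℝ → ℝ}
    (hf : ContDiffOn ℝ ∞ f I) {p r j : ℕ} (hpf : HasParity c p j f) (hbf : DerivBound c A σ j f)
    (hr : r ≤ n) (hrj : r + j ≤ 2 * m + 2) (hpar : Even (p + r + j)) :
    |arcIntegral c (f * curvatureDeriv c (r + j))| ≤
      A * σ ^ j * (B * ρ ^ r) * length c := by
  rw [← arcDeriv_iterate_curvatureDeriv, arcIntegral_mul_arcDeriv_iterate h.smooth h.regular hf
    (h.contDiffOn_curvatureDeriv r) hpf ((h.hasParity r).mono (by omega)) hpar, abs_mul, abs_pow,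
    abs_neg, abs_one, one_pow, one_mul]
  refine abs_arcIntegral_le h.smooth h.regular
    ((contDiffOn_arcDeriv_iterate h.smooth h.regular hf j).mul
      (h.contDiffOn_curvatureDeriv r)).continuousOn fun x hx => ?_
  rw [Pi.mul_apply, abs_mul]
  have h1 := hbf j le_rfl x hx
  exact mul_le_mul h1 (hB r hr x hx) (abs_nonneg _) ((abs_nonneg _).trans h1)

/-- Moving j derivatives off the last factor brings every order into the range n of the pointwise
bounds. The even total order 2w is what removes the boundary terms; 3^j comes from distributing j
derivatives over three factors. -/
theorem abs_arcIntegral_quartic_le (h : BalancedCurve m c) {A ρ : ℝ} {n : ℕ}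
    (hA : ∀ i ≤ n, ∀ x ∈ I, |curvatureDeriv c i x| ≤ A * ρ ^ i) (hn : n ≤ 2 * m + 2)
    {a b d r j w : ℕ} (ha : a + j ≤ n) (hb : b + j ≤ n) (hd : d + j ≤ n) (hr : r ≤ n)
    (hrj : r + j ≤ 2 * m + 2) (hw : a + b + d + r + j = 2 * w) :
    |arcIntegral c (curvatureDeriv c a * curvatureDeriv c b * curvatureDeriv c d *
      curvatureDeriv c (r + j))| ≤ 3 ^ j * (A ^ 4 * ρ ^ (2 * w) * length c) := by
  have hk := h.contDiffOn_curvatureDeriv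
  have hP := fun i (hi : i + j ≤ n) => (h.hasParity i).mono (n' := j) (by omega)
  have hs := h.smooth
  have hreg := h.regular
  have := h.abs_arcIntegral_mul_le hA (((hk a).mul (hk b)).mul (hk d)) (p := a + b + d)
    (((hP a ha).mul hs hreg (hk a) (hk b) (hP b hb)).mul hs hreg ((hk a).mul (hk b)) (hk d)
      (hP d hd))
    (((derivBound_curvatureDeriv hA ha).mul hs hreg (hk a) (hk b)
      (derivBound_curvatureDeriv hA hb)).mul hs hreg
      ((hk a).mul (hk b)) (hk d) (derivBound_curvatureDeriv hA hd)) hr hrj ⟨w, by omega⟩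
  refine this.trans_eq ?_
  rw [← hw, show ρ + ρ + ρ = 3 * ρ by ring, mul_pow]
  ring

/-- The same argument with five factors receiving the j derivatives, hence 5^j. -/
theorem abs_arcIntegral_sextic_le (h : BalancedCurve m c) {A ρ : ℝ} {n : ℕ}
    (hA : ∀ i ≤ n, ∀ x ∈ I, |curvatureDeriv c i x| ≤ A * ρ ^ i) (hn : n ≤ 2 * m + 2)
    {d r j w : ℕ} (hd : d + j ≤ n) (hr : r ≤ n)
    (hrj : r + j ≤ 2 * m + 2) (hw : d + r + j = 2 * w) :
    |arcIntegral c (curvatureDeriv c 0 * curvatureDeriv c 0 * (curvatureDeriv c 0 *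
      curvatureDeriv c 0) * curvatureDeriv c d * curvatureDeriv c (r + j))| ≤
      5 ^ j * (A ^ 6 * ρ ^ (2 * w) * length c) := by
  have hk := h.contDiffOn_curvatureDeriv
  have hP := fun i (hi : i + j ≤ n) => (h.hasParity i).mono (n' := j) (by omega)
  have hs := h.smooth
  have hreg := h.regular
  have h0 : 0 + j ≤ n := by omega
  have hk2 := (hk 0).mul (hk 0)
  have hP2 := (hP 0 h0).mul hs hreg (hk 0) (hk 0) (hP 0 h0)
  have hB2 := (derivBound_curvatureDeriv hA h0).mul hs hreg (hk 0) (hk 0)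
    (derivBound_curvatureDeriv hA h0)
  have := h.abs_arcIntegral_mul_le hA ((hk2.mul hk2).mul (hk d))
    ((hP2.mul hs hreg hk2 hk2 hP2).mul hs hreg (hk2.mul hk2) (hk d) (hP d hd))
    ((hB2.mul hs hreg hk2 hk2 hB2).mul hs hreg (hk2.mul hk2) (hk d)
      (derivBound_curvatureDeriv hA hd)) hr hrj
    ⟨w, by omega⟩
  refine this.trans_eq ?_
  rw [← hw, show ρ + ρ + (ρ + ρ) + ρ = 5 * ρ by ring, mul_pow]
  ring

end BalancedCurve

/-- A bound for `L ∫ k² ds` below which the dissipation terms dominate. -/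
noncomputable def smallness (m : ℕ) : ℝ := (64 * (m + 1) * 5 ^ m)⁻¹

theorem smallness_pos (m : ℕ) : 0 < smallness m := by
  unfold smallness; positivity

theorem smallness_mul (m : ℕ) : (m + 1) * 5 ^ m * smallness m = 1 / 64 := by
  unfold smallness; field_simp

theorem smallness_le_one (m : ℕ) : smallness m ≤ 1 := by
  have h1 : (1 : ℝ) ≤ (m + 1) * 5 ^ m :=
    one_le_mul_of_one_le_of_one_le (by simp) (one_le_pow₀ (by norm_num))
  have := smallness_mul m
  have := smallness_pos m
  nlinarith

theorem abs_sum_Icc_neg_one_pow_le {m : ℕ} {u : ℕ → ℝ} {B : ℝ}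
    (hB : ∀ j ∈ Finset.Icc 1 m, |u j| ≤ B) :
    |∑ j ∈ Finset.Icc 1 m, (-1) ^ j * u j| ≤ m * B := by
  refine (Finset.abs_sum_le_sum_abs _ _).trans ?_
  refine (Finset.sum_le_card_nsmul _ _ B fun j hj => ?_).trans_eq ?_
  · rw [abs_mul, abs_pow, abs_neg, abs_one, one_pow, one_mul]
    exact hB j hj
  · simp

theorem three_pow_le {i m : ℕ} (h : i ≤ m) : (3 : ℝ) ^ i ≤ 5 ^ m :=
  (pow_le_pow_left₀ (by norm_num) (by norm_num) i).trans (pow_le_pow_right₀ (by norm_num) h)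

/-! ### Leading terms against error terms in the evolution equations -/

namespace BalancedCurve

variable {c : ℝ → Plane} {m : ℕ}

theorem arcIntegral_mul_flowSpeed (h : BalancedCurve m c) {f : ℝ → ℝ} (hf : ContinuousOn f I) :
    arcIntegral c (f * flowSpeed m c) =
      (-1) ^ (m + 1) * arcIntegral c (f * curvatureDeriv c (2 * m + 2))
      - ∑ j ∈ Finset.Icc 1 m, (-1) ^ j * arcIntegral c
          (f * curvatureDeriv c 0 * curvatureDeriv c (m - j) * curvatureDeriv c (m + j))
      - 1 / 2 * arcIntegral c
          (f * curvatureDeriv c 0 * curvatureDeriv c m * curvatureDeriv c m) := by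
  have hk := fun j => (h.contDiffOn_curvatureDeriv j).continuousOn
  have hs := h.smooth
  have hr := h.regular
  have hcont : ∀ j, ContinuousOn (fun x => (-1) ^ j *
      (f * curvatureDeriv c 0 * curvatureDeriv c (m - j) * curvatureDeriv c (m + j)) x) I :=
    fun j => continuousOn_const.mul (((hf.mul (hk 0)).mul (hk _)).mul (hk _))
  have h1 : ContinuousOn (fun x => (-1) ^ (m + 1) * (f * curvatureDeriv c (2 * m + 2)) x) I :=
    continuousOn_const.mul (hf.mul (hk _))
  have h2 : ContinuousOn (fun x => 1 / 2 *
      (f * curvatureDeriv c 0 * curvatureDeriv c m * curvatureDeriv c m) x) I :=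
    continuousOn_const.mul (((hf.mul (hk 0)).mul (hk _)).mul (hk _))
  have hsum : ContinuousOn (fun x => ∑ j ∈ Finset.Icc 1 m, (-1) ^ j *
      (f * curvatureDeriv c 0 * curvatureDeriv c (m - j) * curvatureDeriv c (m + j)) x) I :=
    continuousOn_finsetSum _ fun j _ => hcont j
  have hdiff : ContinuousOn (fun x => (-1) ^ (m + 1) * (f * curvatureDeriv c (2 * m + 2)) x -
      ∑ j ∈ Finset.Icc 1 m, (-1) ^ j *
        (f * curvatureDeriv c 0 * curvatureDeriv c (m - j) * curvatureDeriv c (m + j)) x) I :=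
    h1.sub hsum
  simp only [← arcIntegral_const_mul]
  rw [← arcIntegral_sum hs hr _ fun j _ => hcont j, ← arcIntegral_sub hs hr h1 hsum,
    ← arcIntegral_sub hs hr hdiff h2]
  refine arcIntegral_congr fun x _ => ?_
  change f x * flowSpeed m c x = _
  simp only [flowSpeed, Pi.mul_apply, mul_sub, Finset.mul_sum]
  change _ - _ - f x * (1 / 2 * curvatureDeriv c 0 x * curvatureDeriv c m x ^ 2) = _
  congr 1
  · congr 1
    · ring
    · refine Finset.sum_congr rfl fun j _ => ?_
      change f x * ((-1) ^ j * (curvatureDeriv c 0 x * _ * _)) = _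
      ring
  · ring

/-- Balancing the two orders by j integrations by parts exhibits the leading term as a square with a
definite sign. -/
theorem neg_one_pow_mul_arcIntegral (h : BalancedCurve m c) (a : ℕ) {r j : ℕ}
    (haj : a + j ≤ 2 * m + 2) (hrj : r + j ≤ 2 * m + 2) (har : r = a + j) :
    (-1) ^ j * arcIntegral c (curvatureDeriv c a * curvatureDeriv c (r + j)) =
      curvatureNorm c r ^ 2 := by
  rw [← arcDeriv_iterate_curvatureDeriv, arcIntegral_mul_arcDeriv_iterate h.smooth h.regular
    (h.contDiffOn_curvatureDeriv a) (h.contDiffOn_curvatureDeriv r)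
    ((h.hasParity a).mono (by omega)) ((h.hasParity r).mono (by omega)) ⟨r, by omega⟩,
    arcDeriv_iterate_curvatureDeriv, ← har, ← mul_assoc, ← mul_pow, neg_one_mul, neg_neg, one_pow,
    one_mul, curvatureNorm_sq]
  exact arcIntegral_congr fun x _ => by simp [sq]

/-- The length decreases along the flow while `L ∫ k² ds` is small. -/
theorem arcIntegral_curvature_mul_flowSpeed_nonneg (h : BalancedCurve m c)
    (hsmall : length c * energy 0 c ≤ smallness m) :
    0 ≤ arcIntegral c (curvatureDeriv c 0 * flowSpeed m c) := by
  have hL := length_pos h.smooth h.regular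
  obtain ⟨ρ, hρ, -, hle, heq⟩ := h.exists_ratio (N := m + 1) (by omega) (by omega)
  rw [← curvatureNorm_sq] at hsmall
  set a0 := curvatureNorm c 0 with ha0
  have ha0n : 0 ≤ a0 := curvatureNorm_nonneg 0
  set A := √(2 * a0 ^ 2 * ρ) with hAdef
  have hA : ∀ i ≤ m, ∀ x ∈ I, |curvatureDeriv c i x| ≤ A * ρ ^ i := fun i hi x hx =>
    h.abs_curvatureDeriv_le (by omega) hρ hle (by omega) hx
  have hA2 : A ^ 2 = 2 * a0 ^ 2 * ρ := Real.sq_sqrt (by positivity)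
  -- The interpolation order N = m + 1 is chosen so that A⁴ρ^{2m}L is a multiple of L a_0² times the
  -- good term a_{m+1}².
  have hX : A ^ 4 * ρ ^ (2 * m) * length c =
      4 * (length c * a0 ^ 2) * curvatureNorm c (m + 1) ^ 2 := by
    rw [heq, show A ^ 4 = (A ^ 2) ^ 2 by ring, hA2]; ring
  have hX0 : 0 ≤ A ^ 4 * ρ ^ (2 * m) * length c := by positivity
  have hquart : ∀ j ≤ m, |arcIntegral c (curvatureDeriv c 0 * curvatureDeriv c 0 *
      curvatureDeriv c (m - j) * curvatureDeriv c (m + j))| ≤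
      5 ^ m * (A ^ 4 * ρ ^ (2 * m) * length c) := fun j hj =>
    (h.abs_arcIntegral_quartic_le hA (by omega) (by omega) (by omega) (by omega) le_rfl (by omega)
      (by omega)).trans (mul_le_mul_of_nonneg_right (three_pow_le hj) hX0)
  have hsum := abs_sum_Icc_neg_one_pow_le (m := m) (u := fun j => arcIntegral c
    (curvatureDeriv c 0 * curvatureDeriv c 0 * curvatureDeriv c (m - j) * curvatureDeriv c (m + j)))
    fun j hj => hquart j (Finset.mem_Icc.1 hj).2
  have hlast := hquart 0 (Nat.zero_le m)
  simp only [Nat.sub_zero, Nat.add_zero] at hlast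
  have hlead := h.neg_one_pow_mul_arcIntegral 0 (r := m + 1) (j := m + 1) (by omega) (by omega)
    (by omega)
  rw [show m + 1 + (m + 1) = 2 * m + 2 by ring] at hlead
  rw [h.arcIntegral_mul_flowSpeed (h.contDiffOn_curvatureDeriv 0).continuousOn, hlead]
  have hbound : (m + 1) * (5 ^ m * (A ^ 4 * ρ ^ (2 * m) * length c)) ≤
      curvatureNorm c (m + 1) ^ 2 := by
    rw [hX]
    have h1 : (m + 1) * 5 ^ m * (length c * a0 ^ 2) ≤ 1 / 64 :=
      (mul_le_mul_of_nonneg_left hsmall (by positivity)).trans_eq (smallness_mul m)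
    have := mul_le_mul_of_nonneg_right h1 (sq_nonneg (curvatureNorm c (m + 1)))
    have := sq_nonneg (curvatureNorm c (m + 1))
    linarith
  have := (abs_le.1 hsum).2
  have := (abs_le.1 hlast).2
  have : 0 ≤ 5 ^ m * (A ^ 4 * ρ ^ (2 * m) * length c) := by positivity
  linarith

/-- The right-hand side of the evolution equation of `∫ k² ds`, estimated while `L ∫ k² ds` is
small. -/
theorem dissipation (h : BalancedCurve m c)
    (hsmall : length c * energy 0 c ≤ smallness m) :
    2 * arcIntegral c (curvatureDeriv c 2 * flowSpeed m c) + arcIntegral c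
      (curvatureDeriv c 0 * curvatureDeriv c 0 * curvatureDeriv c 0 * flowSpeed m c) ≤
      -curvatureNorm c (m + 2) ^ 2 := by
  have hL := length_pos h.smooth h.regular
  have hk := h.contDiffOn_curvatureDeriv
  obtain ⟨ρ, hρ, hLρ, hle, heq⟩ := h.exists_ratio (N := m + 2) (by omega) (by omega)
  rw [← curvatureNorm_sq] at hsmall
  set a0 := curvatureNorm c 0 with ha0
  have ha0n : 0 ≤ a0 := curvatureNorm_nonneg 0
  set A := √(2 * a0 ^ 2 * ρ) with hAdef
  have hA : ∀ i ≤ m + 1, ∀ x ∈ I, |curvatureDeriv c i x| ≤ A * ρ ^ i := fun i hi x hx =>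
    h.abs_curvatureDeriv_le (by omega) hρ hle (by omega) hx
  have hA2 : A ^ 2 = 2 * a0 ^ 2 * ρ := Real.sq_sqrt (by positivity)
  set a := curvatureNorm c (m + 2) with ha
  set q := length c * a0 ^ 2 with hq
  have hq0 : 0 ≤ q := by positivity
  set X := A ^ 4 * ρ ^ (2 * (m + 1)) * length c with hXdef
  set Y := A ^ 6 * ρ ^ (2 * m) * length c with hYdef
  have hX : X = 4 * q * a ^ 2 := by
    rw [hXdef, heq, show A ^ 4 = (A ^ 2) ^ 2 by ring, hA2]; ring
  have hY : Y ≤ 16 * q * a ^ 2 := by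
    have hY1 : Y = 8 * length c * a0 ^ 6 * ρ ^ (2 * m + 3) := by
      rw [hYdef, show A ^ 6 = (A ^ 2) ^ 3 by ring, hA2]; ring
    -- By scaling, the sextic bound lacks one factor Lρ compared with the good term; 2Lρ ≥ 1
    -- supplies it.
    have h1 : Y * 1 ≤ Y * (2 * length c * ρ) := mul_le_mul_of_nonneg_left hLρ (by positivity)
    have h2 : Y * (2 * length c * ρ) = q * (16 * q * a ^ 2) := by
      rw [hY1, heq]; ring
    have h3 : q * (16 * q * a ^ 2) ≤ 1 * (16 * q * a ^ 2) :=
      mul_le_mul_of_nonneg_right (hsmall.trans (smallness_le_one m)) (by positivity)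
    linarith
  have hX0 : 0 ≤ X := by positivity
  have hY0 : 0 ≤ Y := by positivity
  have hquart : ∀ j ∈ Finset.Icc 1 m, |arcIntegral c (curvatureDeriv c 2 * curvatureDeriv c 0 *
      curvatureDeriv c (m - j) * curvatureDeriv c (m + j))| ≤ 5 ^ m * X := by
    intro j hj
    obtain ⟨hj1, hjm⟩ := Finset.mem_Icc.1 hj
    -- Only j - 1 derivatives are moved: this lowers k_{s^{m+j}} to order m + 1, while k_{ss} is
    -- raised at most to order m + 1. Both are within the pointwise bounds.
    obtain ⟨i, rfl⟩ : ∃ i, j = i + 1 := ⟨j - 1, by omega⟩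
    rw [show m + (i + 1) = m + 1 + i by ring]
    exact (h.abs_arcIntegral_quartic_le hA (by omega) (by omega) (by omega) (by omega) le_rfl
      (by omega) (by omega)).trans (mul_le_mul_of_nonneg_right (three_pow_le (by omega)) hX0)
  have hsext : ∀ j ≤ m, |arcIntegral c (curvatureDeriv c 0 * curvatureDeriv c 0 *
      curvatureDeriv c 0 * curvatureDeriv c 0 * curvatureDeriv c (m - j) *
      curvatureDeriv c (m + j))| ≤ 5 ^ m * Y := by
    intro j hj
    rw [show curvatureDeriv c 0 * curvatureDeriv c 0 * curvatureDeriv c 0 * curvatureDeriv c 0 =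
      curvatureDeriv c 0 * curvatureDeriv c 0 * (curvatureDeriv c 0 * curvatureDeriv c 0) by ring]
    exact (h.abs_arcIntegral_sextic_le hA (by omega) (by omega) (by omega) (by omega)
      (by omega)).trans (mul_le_mul_of_nonneg_right (pow_le_pow_right₀ (by norm_num) hj) hY0)
  have hsum4 := abs_sum_Icc_neg_one_pow_le hquart
  have hsum6 := abs_sum_Icc_neg_one_pow_le fun j hj => hsext j (Finset.mem_Icc.1 hj).2
  have hlast6 := hsext 0 (Nat.zero_le m)
  simp only [Nat.sub_zero, Nat.add_zero] at hlast6
  -- One derivative is moved off k_{ss}, since for m = 0 the pointwise bounds stop at order 1.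
  have hlast4 := h.abs_arcIntegral_quartic_le hA (by omega) (a := 0) (b := m) (d := m) (r := 1)
    (j := 1) (w := m + 1) (by omega) (by omega) (by omega) (by omega) (by omega) (by omega)
  rw [show curvatureDeriv c 0 * curvatureDeriv c m * curvatureDeriv c m * curvatureDeriv c (1 + 1) =
    curvatureDeriv c 2 * curvatureDeriv c 0 * curvatureDeriv c m * curvatureDeriv c m by
      rw [one_add_one_eq_two]; ring] at hlast4
  have htop := h.abs_arcIntegral_quartic_le hA (by omega) (a := 0) (b := 0) (d := 0) (r := m + 1)
    (j := m + 1) (w := m + 1) (by omega) (by omega) (by omega) (by omega) (by omega) (by omega)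
  rw [show m + 1 + (m + 1) = 2 * m + 2 by ring] at htop
  have hlead := h.neg_one_pow_mul_arcIntegral 2 (r := m + 2) (j := m) (by omega) (by omega)
    (by omega)
  rw [show m + 2 + m = 2 * m + 2 by ring] at hlead
  rw [h.arcIntegral_mul_flowSpeed (hk 2).continuousOn,
    h.arcIntegral_mul_flowSpeed (f := curvatureDeriv c 0 * curvatureDeriv c 0 * curvatureDeriv c 0)
      (((hk 0).mul (hk 0)).mul (hk 0)).continuousOn, pow_succ (-1 : ℝ) m,
    mul_neg_one, neg_mul, hlead]
  have htop' : -(-1) ^ m * arcIntegral c (curvatureDeriv c 0 * curvatureDeriv c 0 *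
      curvatureDeriv c 0 * curvatureDeriv c (2 * m + 2)) ≤ 3 * (5 ^ m * X) := by
    refine (le_abs_self _).trans ?_
    rw [abs_mul, abs_neg, abs_pow, abs_neg, abs_one, one_pow, one_mul]
    refine htop.trans ?_
    rw [pow_succ]
    have := mul_le_mul_of_nonneg_right (three_pow_le (le_refl m)) hX0
    linarith
  have hP : (1 : ℝ) ≤ 5 ^ m := one_le_pow₀ (by norm_num)
  have hPX : X ≤ 5 ^ m * X := by nlinarith
  have hm0 : (0 : ℝ) ≤ m := by positivity
  -- Since X = 4qa² and Y ≤ 16qa², the left side is at most (24 + 16)/64 · a². The leading term is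
  -- -2a², so -a² is left over.
  have hbound : (m + 1) * (5 ^ m * X) * 6 + (m + 1) * (5 ^ m * Y) ≤ a ^ 2 := by
    have h1 : (m + 1) * 5 ^ m * q ≤ 1 / 64 :=
      (mul_le_mul_of_nonneg_left hsmall (by positivity)).trans_eq (smallness_mul m)
    have h2 := mul_le_mul_of_nonneg_right h1 (sq_nonneg a)
    have h3 : (m + 1) * 5 ^ m * Y ≤ (m + 1) * 5 ^ m * (16 * q * a ^ 2) :=
      mul_le_mul_of_nonneg_left hY (by positivity)
    rw [hX]
    have := sq_nonneg a
    linarith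
  have e1 := (abs_le.1 hsum4).1
  have e2 := (abs_le.1 hsum6).1
  have e3 := (abs_le.1 hlast4).1
  have e4 := (abs_le.1 hlast6).1
  have e5 : 0 ≤ m * (5 ^ m * X) := by positivity
  have e6 : 0 ≤ 5 ^ m * Y := by positivity
  rw [neg_mul] at htop'
  linarith

theorem energy_zero_le (h : BalancedCurve m c) {n : ℕ} (hn : n ≤ 2 * m + 3) :
    energy 0 c ≤ (2 * length c) ^ (2 * n) * energy n c := by
  have := pow_le_pow_left₀ (curvatureNorm_nonneg 0) (h.curvatureNorm_le_pow hn) 2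
  rwa [mul_pow, ← pow_mul, curvatureNorm_sq, curvatureNorm_sq, mul_comm n] at this

end BalancedCurve

/-! ### Calculus on the space-time strip up to its boundary -/

section Joint

variable {E : Type} [NormedAddCommGroup E] [NormedSpace ℝ E] {J : Set ℝ}

theorem uniqueDiffOn_strip (hJ : IsOpen J) : UniqueDiffOn ℝ (I ×ˢ J) :=
  uniqueDiffOn_I.prod hJ.uniqueDiffOn

theorem hasDerivWithinAt_space {G : ℝ × ℝ → E} {G' : ℝ × ℝ →L[ℝ] E} {x t : ℝ} (ht : t ∈ J)
    (h : HasFDerivWithinAt G G' (I ×ˢ J) (x, t)) :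
    HasDerivWithinAt (fun y => G (y, t)) (G' (1, 0)) I x := by
  have h1 : HasDerivWithinAt (fun y : ℝ => (y, t)) ((1 : ℝ), (0 : ℝ)) I x :=
    (hasDerivWithinAt_id x I).prodMk (hasDerivWithinAt_const x I t)
  have hm : MapsTo (fun y : ℝ => (y, t)) I (I ×ˢ J) := fun y hy => ⟨hy, ht⟩
  exact h.comp_hasDerivWithinAt x h1 hm

theorem hasDerivAt_time (hJ : IsOpen J) {G : ℝ × ℝ → E} {G' : ℝ × ℝ →L[ℝ] E} {x t : ℝ}
    (hx : x ∈ I) (ht : t ∈ J) (h : HasFDerivWithinAt G G' (I ×ˢ J) (x, t)) :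
    HasDerivAt (fun s => G (x, s)) (G' (0, 1)) t := by
  have h1 : HasDerivWithinAt (fun s : ℝ => (x, s)) ((0 : ℝ), (1 : ℝ)) J t :=
    (hasDerivWithinAt_const t J x).prodMk (hasDerivWithinAt_id t J)
  exact (h.comp_hasDerivWithinAt t h1 fun s hs => ⟨hx, hs⟩).hasDerivAt (hJ.mem_nhds ht)

variable {g : ℝ → ℝ → E}

theorem hasFDerivWithinAt_strip (hg : ContDiffOn ℝ ∞ (fun p : ℝ × ℝ => g p.1 p.2) (I ×ˢ J))
    {x t : ℝ} (hx : x ∈ I) (ht : t ∈ J) :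
    HasFDerivWithinAt (fun p : ℝ × ℝ => g p.1 p.2)
      (fderivWithin ℝ (fun p : ℝ × ℝ => g p.1 p.2) (I ×ˢ J) (x, t)) (I ×ˢ J) (x, t) :=
  (hg.differentiableOn (by simp) (x, t) ⟨hx, ht⟩).hasFDerivWithinAt

theorem contDiffOn_fderivWithin_strip (hJ : IsOpen J)
    (hg : ContDiffOn ℝ ∞ (fun p : ℝ × ℝ => g p.1 p.2) (I ×ˢ J)) :
    ContDiffOn ℝ ∞ (fderivWithin ℝ (fun p : ℝ × ℝ => g p.1 p.2) (I ×ˢ J)) (I ×ˢ J) :=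
  hg.fderivWithin (uniqueDiffOn_strip hJ) (by simp)

theorem derivWithin_eq_fderivWithin
    (hg : ContDiffOn ℝ ∞ (fun p : ℝ × ℝ => g p.1 p.2) (I ×ˢ J)) {x t : ℝ} (hx : x ∈ I)
    (ht : t ∈ J) : derivWithin (fun y => g y t) I x =
      fderivWithin ℝ (fun p : ℝ × ℝ => g p.1 p.2) (I ×ˢ J) (x, t) (1, 0) :=
  (hasDerivWithinAt_space ht (hasFDerivWithinAt_strip hg hx ht)).derivWithin (uniqueDiffOn_I x hx)

theorem contDiffOn_slice (hg : ContDiffOn ℝ ∞ (fun p : ℝ × ℝ => g p.1 p.2) (I ×ˢ J)) {t : ℝ}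
    (ht : t ∈ J) : ContDiffOn ℝ ∞ (fun y => g y t) I :=
  hg.comp (f := fun y : ℝ => (y, t)) (contDiffOn_id.prodMk contDiffOn_const) fun _ hy => ⟨hy, ht⟩

theorem contDiffOn_joint_derivWithin (hJ : IsOpen J)
    (hg : ContDiffOn ℝ ∞ (fun p : ℝ × ℝ => g p.1 p.2) (I ×ˢ J)) :
    ContDiffOn ℝ ∞ (fun p : ℝ × ℝ => derivWithin (fun y => g y p.2) I p.1) (I ×ˢ J) :=
  ((contDiffOn_fderivWithin_strip hJ hg).clm_apply contDiffOn_const).congr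
    fun _ hp => derivWithin_eq_fderivWithin hg hp.1 hp.2

/-- Space and time derivatives commute up to the boundary of the strip. -/
theorem hasDerivAt_derivWithin (hJ : IsOpen J)
    (hg : ContDiffOn ℝ ∞ (fun p : ℝ × ℝ => g p.1 p.2) (I ×ˢ J)) {g' : ℝ → E} {x t : ℝ}
    (ht : t ∈ J) (hg' : ∀ y ∈ I, HasDerivAt (fun s => g y s) (g' y) t) (hx : x ∈ I) :
    HasDerivAt (fun s => derivWithin (fun y => g y s) I x) (derivWithin g' I x) t := by
  set G : ℝ × ℝ → E := fun p => g p.1 p.2 with hG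
  set S : Set (ℝ × ℝ) := I ×ˢ J with hS
  have hD := contDiffOn_fderivWithin_strip hJ hg
  have hDD : HasFDerivWithinAt (fderivWithin ℝ G S) (fderivWithin ℝ (fderivWithin ℝ G S) S (x, t))
      S (x, t) := (hD.differentiableOn (by simp) (x, t) ⟨hx, ht⟩).hasFDerivWithinAt
  -- Points of the lateral boundary are limits of interior points, which gives symmetry of the
  -- second derivative there too.
  have hcl : (x, t) ∈ closure (interior S) := by
    rw [hS, interior_prod_eq, interior_Icc, hJ.interior_eq, closure_prod_eq,
      closure_Ioo (by norm_num)]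
    exact ⟨hx, subset_closure ht⟩
  have hsymm : IsSymmSndFDerivWithinAt ℝ G S (x, t) :=
    (hg (x, t) ⟨hx, ht⟩).isSymmSndFDerivWithinAt
      (by simpa using (WithTop.coe_le_coe.2 le_top : ((2 : ℕ∞) : WithTop ℕ∞) ≤ ∞))
      (uniqueDiffOn_strip hJ) hcl ⟨hx, ht⟩
  have h1 := (hasDerivAt_time hJ hx ht hDD).clm_apply (hasDerivAt_const t ((1 : ℝ), (0 : ℝ)))
  have h2 := (hasDerivWithinAt_space ht hDD).clm_apply
    (hasDerivWithinAt_const x I ((0 : ℝ), (1 : ℝ)))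
  simp only [map_zero, add_zero] at h1 h2
  have h3 : HasDerivWithinAt g' (fderivWithin ℝ (fderivWithin ℝ G S) S (x, t) (1, 0) (0, 1)) I x :=
    h2.congr (fun y hy => (hg' y hy).unique
      (hasDerivAt_time hJ hy ht (hasFDerivWithinAt_strip hg hy ht)))
      ((hg' x hx).unique (hasDerivAt_time hJ hx ht (hasFDerivWithinAt_strip hg hx ht)))
  rw [h3.derivWithin (uniqueDiffOn_I x hx), hsymm.eq]
  refine h1.congr_of_eventuallyEq ?_
  filter_upwards [hJ.mem_nhds ht] with s hs
  exact derivWithin_eq_fderivWithin hg hx hs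

/-- Dominated differentiation: the time derivative is continuous, hence bounded on I times a small
closed ball around t. -/
theorem hasDerivAt_integral_strip {g : ℝ → ℝ → ℝ} (hJ : IsOpen J)
    (hg : ContDiffOn ℝ ∞ (fun p : ℝ × ℝ => g p.1 p.2) (I ×ˢ J)) {g' : ℝ → ℝ} {t : ℝ}
    (ht : t ∈ J) (hg' : ∀ y ∈ I, HasDerivAt (fun s => g y s) (g' y) t) :
    HasDerivAt (fun s => ∫ x in (-1 : ℝ)..1, g x s) (∫ x in (-1 : ℝ)..1, g' x) t := by
  set G : ℝ × ℝ → ℝ := fun p => g p.1 p.2 with hG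
  set S : Set (ℝ × ℝ) := I ×ˢ J with hS
  have hDt : ContinuousOn (fun p : ℝ × ℝ => fderivWithin ℝ G S p (0, 1)) S :=
    (contDiffOn_fderivWithin_strip hJ hg).continuousOn.clm_apply continuousOn_const
  obtain ⟨ε, hε, hball⟩ := Metric.nhds_basis_closedBall.mem_iff.1 (hJ.mem_nhds ht)
  have hcpt : IsCompact (I ×ˢ Metric.closedBall t ε) :=
    isCompact_Icc.prod (isCompact_closedBall t ε)
  obtain ⟨B, hB⟩ := hcpt.exists_bound_of_continuousOn (hDt.mono (prod_mono_right hball))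
  have hIoc : ∀ x, x ∈ Set.uIoc (-1 : ℝ) 1 → x ∈ I := fun x hx => by
    rw [uIoc_of_le (by norm_num)] at hx
    exact Ioc_subset_Icc_self hx
  have hcont : ∀ s ∈ J, ContinuousOn (fun x => g x s) I := fun s hs =>
    (contDiffOn_slice hg hs).continuousOn
  have hmeas : ∀ {f : ℝ → ℝ}, ContinuousOn f I →
      AEStronglyMeasurable f (volume.restrict (Set.uIoc (-1 : ℝ) 1)) := fun hf =>
    (hf.mono hIoc).aestronglyMeasurable measurableSet_uIoc
  have key := intervalIntegral.hasDerivAt_integral_of_dominated_loc_of_deriv_le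
    (μ := volume) (a := -1) (b := 1) (F := fun s x => g x s)
    (F' := fun s x => fderivWithin ℝ G S (x, s) (0, 1)) (x₀ := t) (bound := fun _ => B)
    (Metric.ball_mem_nhds t hε)
    (by filter_upwards [hJ.mem_nhds ht] with s hs using hmeas (hcont s hs))
    ((hcont t ht).intervalIntegrable_of_Icc (by norm_num))
    (hmeas (hDt.comp (f := fun x : ℝ => (x, t)) (by fun_prop) fun x hx => ⟨hx, ht⟩))
    (Filter.Eventually.of_forall fun x hx s hs =>
      hB (x, s) ⟨hIoc x hx, Metric.ball_subset_closedBall hs⟩)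
    intervalIntegrable_const
    (Filter.Eventually.of_forall fun x hx s hs => by
      have hsJ := hball (Metric.ball_subset_closedBall hs)
      exact hasDerivAt_time hJ (hIoc x hx) hsJ (hasFDerivWithinAt_strip hg (hIoc x hx) hsJ))
  refine key.2.congr_deriv (intervalIntegral.integral_congr fun x hx => ?_)
  rw [uIcc_eq_I] at hx
  exact (hasDerivAt_time hJ hx ht (hasFDerivWithinAt_strip hg hx ht)).unique (hg' x hx)

end Joint

/-! ### The moving frame and the Frenet equations -/

section Frame

theorem inner_eq (v w : Plane) : inner ℝ v w = v 0 * w 0 + v 1 * w 1 := by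
  simp [PiLp.inner_apply, Fin.sum_univ_two, mul_comm]

/-- The rotation by a quarter turn as a continuous linear map. -/
noncomputable def rotL : Plane →L[ℝ] Plane :=
  LinearMap.toContinuousLinearMap
    { toFun := rot
      map_add' := fun v w => by
        ext i; fin_cases i <;> simp [rot, add_comm]
      map_smul' := fun r v => by
        ext i; fin_cases i <;> simp [rot] }

theorem rotL_apply (v : Plane) : rotL v = rot v := rfl

theorem rot_smul (r : ℝ) (v : Plane) : rot (r • v) = r • rot v := rotL.map_smul r v

theorem rot_rot (v : Plane) : rot (rot v) = -v := by
  ext i; fin_cases i <;> simp [rot]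

theorem inner_rot_rot (v w : Plane) : inner ℝ (rot v) (rot w) = (inner ℝ v w : ℝ) := by
  simp only [inner_eq, rot]; simp; ring

theorem inner_rot_self (v : Plane) : inner ℝ v (rot v) = (0 : ℝ) := by
  simp only [inner_eq, rot]; simp; ring

theorem inner_rot_left_self (v : Plane) : inner ℝ (rot v) v = (0 : ℝ) := by
  rw [real_inner_comm, inner_rot_self]

theorem inner_sq_add_inner_rot_sq (v w : Plane) :
    inner ℝ v w ^ 2 + inner ℝ v (rot w) ^ 2 = ‖v‖ ^ 2 * ‖w‖ ^ 2 := by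
  rw [← real_inner_self_eq_norm_sq, ← real_inner_self_eq_norm_sq]
  simp only [inner_eq, rot]; simp; ring

theorem eq_smul_rot_of_inner_eq_zero {v w : Plane} (hv : ‖v‖ = 1) (h : inner ℝ w v = (0 : ℝ)) :
    w = (inner ℝ w (rot v) : ℝ) • rot v := by
  have h1 : v 0 * v 0 + v 1 * v 1 = 1 := by
    rw [← inner_eq, real_inner_self_eq_norm_sq, hv, one_pow]
  rw [inner_eq] at h
  rw [inner_eq]
  ext i
  fin_cases i
  · simp [rot]
    linear_combination (-w 0) * h1 + v 0 * h
  · simp [rot]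
    linear_combination (-w 1) * h1 + v 1 * h

variable {c : ℝ → Plane} {x : ℝ}

theorem derivWithin_eq_smul_tangent (hr : IsRegular c) (hx : x ∈ I) :
    derivWithin c I x = speed c x • tangent c x := by
  rw [tangent, arcDeriv, smul_inv_smul₀ (speed_pos hr hx).ne']

theorem norm_tangent (hr : IsRegular c) (hx : x ∈ I) : ‖tangent c x‖ = 1 := by
  have := speed_pos hr hx
  rw [tangent, arcDeriv, norm_smul, norm_inv, Real.norm_of_nonneg this.le]
  exact inv_mul_cancel₀ this.ne'

theorem inner_normal_self (hr : IsRegular c) (hx : x ∈ I) :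
    inner ℝ (normal c x) (normal c x) = (1 : ℝ) := by
  rw [normal, inner_rot_rot, real_inner_self_eq_norm_sq, norm_tangent hr hx, one_pow]

theorem contDiffOn_tangent (hc : ContDiffOn ℝ ∞ c I) (hr : IsRegular c) :
    ContDiffOn ℝ ∞ (tangent c) I := contDiffOn_arcDeriv hc hr hc

/-- The tangent has constant length, so its derivative is normal, and the coefficient is the
curvature by definition. -/
theorem hasDerivWithinAt_tangent (hc : ContDiffOn ℝ ∞ c I) (hr : IsRegular c) (hx : x ∈ I) :
    HasDerivWithinAt (tangent c) ((speed c x * curvature c x) • normal c x) I x := by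
  have hd := (differentiableWithinAt_of_smooth (contDiffOn_tangent hc hr) hx).hasDerivWithinAt
  have h1 := hd.inner ℝ hd
  have h2 : HasDerivWithinAt (fun y => inner ℝ (tangent c y) (tangent c y)) (0 : ℝ) I x :=
    (hasDerivWithinAt_const x I (1 : ℝ)).congr
      (fun y hy => by rw [real_inner_self_eq_norm_sq, norm_tangent hr hy, one_pow])
      (by rw [real_inner_self_eq_norm_sq, norm_tangent hr hx, one_pow])
  have h3 := (uniqueDiffOn_I x hx).eq_deriv _ h1 h2
  rw [real_inner_comm] at h3
  have h4 : inner ℝ (derivWithin (tangent c) I x) (tangent c x) = (0 : ℝ) := by linarith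
  rw [eq_smul_rot_of_inner_eq_zero (norm_tangent hr hx) h4] at hd
  have h5 : speed c x * curvature c x =
      inner ℝ (derivWithin (tangent c) I x) (rot (tangent c x)) := by
    rw [curvature, arcDeriv, real_inner_smul_left, mul_inv_cancel_left₀ (speed_pos hr hx).ne',
      normal]
  rwa [h5]

theorem hasDerivWithinAt_normal (hc : ContDiffOn ℝ ∞ c I) (hr : IsRegular c) (hx : x ∈ I) :
    HasDerivWithinAt (normal c) (-(speed c x * curvature c x) • tangent c x) I x := by
  have h := rotL.hasFDerivAt.comp_hasDerivWithinAt x (hasDerivWithinAt_tangent hc hr hx)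
  refine h.congr_deriv ?_
  rw [rotL_apply, rot_smul, normal, rot_rot, smul_neg, neg_smul]

theorem derivWithin_smul_normal (hc : ContDiffOn ℝ ∞ c I) (hr : IsRegular c) {f : ℝ → ℝ}
    (hf : ContDiffOn ℝ ∞ f I) (hx : x ∈ I) :
    derivWithin (fun y => f y • normal c y) I x =
      (speed c x * arcDeriv c f x) • normal c x -
        (f x * (speed c x * curvature c x)) • tangent c x := by
  have h := (differentiableWithinAt_of_smooth hf hx).hasDerivWithinAt.smul
    (hasDerivWithinAt_normal hc hr hx)
  refine (h.derivWithin (uniqueDiffOn_I x hx)).trans ?_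
  rw [mul_comm (speed c x) (arcDeriv c f x), arcDeriv_mul_speed hr f hx]
  module

end Frame

/-- A smooth family of regular curves, parametrised by the times in an open set `J`, that moves in
the normal direction with speed `F`. -/
structure NormalFlow (J : Set ℝ) (γ : ℝ → ℝ → Plane) (F : ℝ → ℝ → ℝ) : Prop where
  isOpen : IsOpen J
  smooth : ContDiffOn ℝ ∞ (fun p : ℝ × ℝ => γ p.1 p.2) (I ×ˢ J)
  regular : ∀ t ∈ J, IsRegular fun y => γ y t
  smooth_speed : ∀ t ∈ J, ContDiffOn ℝ ∞ (fun y => F y t) I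
  flow : ∀ t ∈ J, ∀ x ∈ I, HasDerivAt (fun s => γ x s) (F x t • normal (fun y => γ y t) x) t

/-! ### Evolution equations under a normal flow -/

namespace NormalFlow

variable {J : Set ℝ} {γ : ℝ → ℝ → Plane} {F : ℝ → ℝ → ℝ}

theorem smooth_slice (h : NormalFlow J γ F) {t : ℝ} (ht : t ∈ J) :
    ContDiffOn ℝ ∞ (fun y => γ y t) I := contDiffOn_slice h.smooth ht

theorem contDiffOn_speed (h : NormalFlow J γ F) :
    ContDiffOn ℝ ∞ (fun p : ℝ × ℝ => speed (fun y => γ y p.2) p.1) (I ×ˢ J) :=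
  (contDiffOn_joint_derivWithin h.isOpen h.smooth).norm ℝ
    fun p hp => h.regular p.2 hp.2 p.1 hp.1

theorem contDiffOn_arcDeriv (h : NormalFlow J γ F) {E : Type} [NormedAddCommGroup E]
    [NormedSpace ℝ E] {g : ℝ → ℝ → E}
    (hg : ContDiffOn ℝ ∞ (fun p : ℝ × ℝ => g p.1 p.2) (I ×ˢ J)) :
    ContDiffOn ℝ ∞ (fun p : ℝ × ℝ => arcDeriv (fun y => γ y p.2) (fun y => g y p.2) p.1)
      (I ×ˢ J) :=
  (h.contDiffOn_speed.inv fun p hp => (speed_pos (h.regular p.2 hp.2) hp.1).ne').smul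
    (contDiffOn_joint_derivWithin h.isOpen hg)

theorem contDiffOn_tangent (h : NormalFlow J γ F) :
    ContDiffOn ℝ ∞ (fun p : ℝ × ℝ => tangent (fun y => γ y p.2) p.1) (I ×ˢ J) :=
  h.contDiffOn_arcDeriv h.smooth

theorem contDiffOn_curvature (h : NormalFlow J γ F) :
    ContDiffOn ℝ ∞ (fun p : ℝ × ℝ => curvature (fun y => γ y p.2) p.1) (I ×ˢ J) :=
  (h.contDiffOn_arcDeriv (g := fun y s => tangent (fun y => γ y s) y) h.contDiffOn_tangent).inner ℝ
    (contDiffOn_rot h.contDiffOn_tangent)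

variable {x t : ℝ}

theorem hasDerivAt_derivWithin (h : NormalFlow J γ F) (ht : t ∈ J) (hx : x ∈ I) :
    HasDerivAt (fun s => derivWithin (fun y => γ y s) I x)
      ((speed (fun y => γ y t) x * arcDeriv (fun y => γ y t) (fun y => F y t) x) •
          normal (fun y => γ y t) x -
        (F x t * (speed (fun y => γ y t) x * curvature (fun y => γ y t) x)) •
          tangent (fun y => γ y t) x) t := by
  rw [← derivWithin_smul_normal (h.smooth_slice ht) (h.regular t ht) (h.smooth_speed t ht) hx]
  exact CurveFlow.hasDerivAt_derivWithin h.isOpen h.smooth ht (h.flow t ht) hx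

/-- The evolution of the arclength element. -/
theorem hasDerivAt_speed (h : NormalFlow J γ F) (ht : t ∈ J) (hx : x ∈ I) :
    HasDerivAt (fun s => speed (fun y => γ y s) x)
      (-(F x t * (speed (fun y => γ y t) x * curvature (fun y => γ y t) x))) t := by
  have hr := h.regular t ht
  have hv := speed_pos hr hx
  have h1 := (h.hasDerivAt_derivWithin ht hx).norm_sq.sqrt
    (pow_ne_zero 2 (norm_ne_zero_iff.2 (hr x hx)))
  simp only [Real.sqrt_sq (norm_nonneg _)] at h1
  refine h1.congr_deriv ?_
  change 2 * _ / (2 * speed (fun y => γ y t) x) = _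
  rw [derivWithin_eq_smul_tangent hr hx, real_inner_smul_left, inner_sub_right,
    real_inner_smul_right, real_inner_smul_right, real_inner_self_eq_norm_sq, norm_tangent hr hx,
    normal, inner_rot_self]
  field_simp
  ring

/-- The evolution of the unit tangent. -/
theorem hasDerivAt_tangent (h : NormalFlow J γ F) (ht : t ∈ J) (hx : x ∈ I) :
    HasDerivAt (fun s => tangent (fun y => γ y s) x)
      (arcDeriv (fun y => γ y t) (fun y => F y t) x • normal (fun y => γ y t) x) t := by
  have hr := h.regular t ht
  have hv := (speed_pos hr hx).ne'
  have h1 := ((h.hasDerivAt_speed ht hx).inv hv).smul (h.hasDerivAt_derivWithin ht hx)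
  refine h1.congr_deriv ?_
  rw [derivWithin_eq_smul_tangent hr hx, smul_sub, smul_smul, smul_smul, smul_smul, Pi.inv_apply]
  have e1 : (speed (fun y => γ y t) x)⁻¹ *
      (speed (fun y => γ y t) x * arcDeriv (fun y => γ y t) (fun y => F y t) x) =
      arcDeriv (fun y => γ y t) (fun y => F y t) x := by
    rw [inv_mul_cancel_left₀ hv]
  have e2 : (speed (fun y => γ y t) x)⁻¹ *
      (F x t * (speed (fun y => γ y t) x * curvature (fun y => γ y t) x)) =
      -(-(F x t * (speed (fun y => γ y t) x * curvature (fun y => γ y t) x))) /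
        speed (fun y => γ y t) x ^ 2 * speed (fun y => γ y t) x := by
    field_simp
  rw [e1, e2]
  module

theorem hasDerivAt_normal (h : NormalFlow J γ F) (ht : t ∈ J) (hx : x ∈ I) :
    HasDerivAt (fun s => normal (fun y => γ y s) x)
      (-arcDeriv (fun y => γ y t) (fun y => F y t) x • tangent (fun y => γ y t) x) t := by
  have h1 := rotL.hasFDerivAt.comp_hasDerivAt t (h.hasDerivAt_tangent ht hx)
  refine h1.congr_deriv ?_
  rw [rotL_apply, rot_smul, normal, rot_rot, smul_neg, neg_smul]

/-- The evolution of the curvature measure `k ds`. -/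
theorem hasDerivAt_speed_mul_curvature (h : NormalFlow J γ F) (ht : t ∈ J) (hx : x ∈ I) :
    HasDerivAt (fun s => speed (fun y => γ y s) x * curvature (fun y => γ y s) x)
      (speed (fun y => γ y t) x *
        arcDeriv (fun y => γ y t) (arcDeriv (fun y => γ y t) (fun y => F y t)) x) t := by
  have hr := h.regular t ht
  have hs := h.smooth_slice ht
  have hFs := CurveFlow.contDiffOn_arcDeriv hs hr (h.smooth_speed t ht)
  have h1 := CurveFlow.hasDerivAt_derivWithin h.isOpen h.contDiffOn_tangent ht
    (fun y hy => h.hasDerivAt_tangent ht hy) hx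
  rw [derivWithin_smul_normal hs hr hFs hx] at h1
  have h2 := h1.inner ℝ (h.hasDerivAt_normal ht hx)
  -- Writing k ds as ⟨∂ₓτ, ν⟩ dx avoids differentiating the curvature itself. In its time derivative
  -- the term with ν_t drops out, since ∂ₓτ is normal and ν_t tangential.
  have heq : ∀ s ∈ J, inner ℝ (derivWithin (fun y => tangent (fun y => γ y s) y) I x)
      (normal (fun y => γ y s) x) = speed (fun y => γ y s) x * curvature (fun y => γ y s) x := by
    intro s hsJ
    have hrs := h.regular s hsJ
    have := (hasDerivWithinAt_tangent (h.smooth_slice hsJ) hrs hx).derivWithin (uniqueDiffOn_I x hx)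
    change inner ℝ (derivWithin (tangent fun y => γ y s) I x) _ = _
    rw [this, real_inner_smul_left, inner_normal_self hrs hx, mul_one]
  have h3 := h2.congr_of_eventuallyEq (f₁ := fun s =>
    speed (fun y => γ y s) x * curvature (fun y => γ y s) x) (by
      filter_upwards [h.isOpen.mem_nhds ht] with s hsJ using (heq s hsJ).symm)
  refine h3.congr_deriv ?_
  have e1 := (hasDerivWithinAt_tangent hs hr hx).derivWithin (uniqueDiffOn_I x hx)
  change inner ℝ (derivWithin (tangent fun y => γ y t) I x) _ + _ = _
  rw [e1, real_inner_smul_left, real_inner_smul_right, inner_sub_left, real_inner_smul_left,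
    real_inner_smul_left, inner_normal_self hr hx, normal, inner_rot_self, inner_rot_left_self]
  ring

/-- The evolution of `k² ds`. -/
theorem hasDerivAt_curvature_sq_mul_speed (h : NormalFlow J γ F) (ht : t ∈ J) (hx : x ∈ I) :
    HasDerivAt (fun s => curvature (fun y => γ y s) x ^ 2 * speed (fun y => γ y s) x)
      ((2 * (curvature (fun y => γ y t) x *
          arcDeriv (fun y => γ y t) (arcDeriv (fun y => γ y t) (fun y => F y t)) x) +
        curvature (fun y => γ y t) x ^ 3 * F x t) * speed (fun y => γ y t) x) t := by
  have hv := (speed_pos (h.regular t ht) hx).ne'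
  -- Here k² ds is the quotient (k ds)²/ds of quantities with known evolution.
  have h1 := ((h.hasDerivAt_speed_mul_curvature ht hx).pow 2).div (h.hasDerivAt_speed ht hx) hv
  have h2 := h1.congr_of_eventuallyEq (f₁ := fun s =>
    curvature (fun y => γ y s) x ^ 2 * speed (fun y => γ y s) x) (by
      filter_upwards [h.isOpen.mem_nhds ht] with s hs
      have := (speed_pos (h.regular s hs) hx).ne'
      simp only [Pi.div_apply, Pi.pow_apply]
      field_simp)
  refine h2.congr_deriv ?_
  simp only [Pi.pow_apply]
  field_simp
  ring

theorem hasDerivAt_length (h : NormalFlow J γ F) (ht : t ∈ J) :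
    HasDerivAt (fun s => length fun y => γ y s)
      (-arcIntegral (fun y => γ y t) (curvature (fun y => γ y t) * fun y => F y t)) t := by
  have h1 := hasDerivAt_integral_strip h.isOpen h.contDiffOn_speed ht
    fun y hy => h.hasDerivAt_speed ht hy
  simp only [length, arcIntegral, one_mul]
  refine h1.congr_deriv ?_
  rw [← intervalIntegral.integral_neg]
  refine intervalIntegral.integral_congr fun x _ => ?_
  simp only [Pi.mul_apply]
  ring

theorem hasDerivAt_arcIntegral_curvature (h : NormalFlow J γ F) (ht : t ∈ J) :
    HasDerivAt (fun s => arcIntegral (fun y => γ y s) (curvature fun y => γ y s))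
      (arcDeriv (fun y => γ y t) (fun y => F y t) 1 -
        arcDeriv (fun y => γ y t) (fun y => F y t) (-1)) t := by
  have hr := h.regular t ht
  have h1 := hasDerivAt_integral_strip (g := fun y s =>
    speed (fun y => γ y s) y * curvature (fun y => γ y s) y) h.isOpen
    (h.contDiffOn_speed.mul h.contDiffOn_curvature) ht
    fun y hy => h.hasDerivAt_speed_mul_curvature ht hy
  rw [← arcIntegral_arcDeriv hr
    (CurveFlow.contDiffOn_arcDeriv (h.smooth_slice ht) hr (h.smooth_speed t ht))]
  simpa only [arcIntegral, mul_comm] using h1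

/-- Two integrations by parts turn ∫k F_{ss} into ∫k_{ss}F; the hypotheses on F_s and k_s remove the
boundary terms. -/
theorem hasDerivAt_energy_zero (h : NormalFlow J γ F) (ht : t ∈ J)
    (hF : arcDeriv (fun y => γ y t) (fun y => F y t) (-1) = 0 ∧
      arcDeriv (fun y => γ y t) (fun y => F y t) 1 = 0)
    (hk : curvatureDeriv (fun y => γ y t) 1 (-1) = 0 ∧ curvatureDeriv (fun y => γ y t) 1 1 = 0) :
    HasDerivAt (fun s => energy 0 fun y => γ y s)
      (2 * arcIntegral (fun y => γ y t) (curvatureDeriv (fun y => γ y t) 2 * fun y => F y t) +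
        arcIntegral (fun y => γ y t) (curvatureDeriv (fun y => γ y t) 0 *
          curvatureDeriv (fun y => γ y t) 0 * curvatureDeriv (fun y => γ y t) 0 *
          fun y => F y t)) t := by
  have hr := h.regular t ht
  have hs := h.smooth_slice ht
  have hFt := h.smooth_speed t ht
  have hFs := CurveFlow.contDiffOn_arcDeriv hs hr hFt
  have hFss := CurveFlow.contDiffOn_arcDeriv hs hr hFs
  have hk0 := contDiffOn_curvatureDeriv hs hr 0
  have hk1 := contDiffOn_curvatureDeriv hs hr 1
  have h1 := hasDerivAt_integral_strip (g := fun y s =>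
    curvature (fun y => γ y s) y ^ 2 * speed (fun y => γ y s) y) h.isOpen
    ((h.contDiffOn_curvature.pow 2).mul h.contDiffOn_speed) ht
    fun y hy => h.hasDerivAt_curvature_sq_mul_speed ht hy
  refine h1.congr_deriv ?_
  have i1 := arcIntegral_mul_arcDeriv hs hr hk0 hFs
  have i2 := arcIntegral_mul_arcDeriv hs hr hk1 hFt
  rw [hF.1, hF.2, arcDeriv_curvatureDeriv] at i1
  rw [hk.1, hk.2, arcDeriv_curvatureDeriv] at i2
  have i3 : arcIntegral (fun y => γ y t) (curvatureDeriv (fun y => γ y t) 2 * fun y => F y t) =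
      arcIntegral (fun y => γ y t) (curvatureDeriv (fun y => γ y t) 0 *
        arcDeriv (fun y => γ y t) (arcDeriv (fun y => γ y t) fun y => F y t)) := by
    rw [i1]
    linarith
  have i4 := arcIntegral_add hs hr
    (f := fun x => 2 * (curvatureDeriv (fun y => γ y t) 0 *
      arcDeriv (fun y => γ y t) (arcDeriv (fun y => γ y t) fun y => F y t)) x)
    (g := curvatureDeriv (fun y => γ y t) 0 * curvatureDeriv (fun y => γ y t) 0 *
      curvatureDeriv (fun y => γ y t) 0 * fun y => F y t)
    (continuousOn_const.mul (hk0.continuousOn.mul hFss.continuousOn))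
    (((hk0.mul hk0).mul hk0).mul hFt).continuousOn
  rw [i3, ← arcIntegral_const_mul]
  refine Eq.trans ?_ i4
  refine intervalIntegral.integral_congr fun x _ => ?_
  simp only [Pi.mul_apply]
  change _ = (2 * (curvature _ x * _) + curvature _ x * curvature _ x * curvature _ x * _) * _
  ring

/-- If the end points of the curves meet a fixed direction orthogonally, then the derivative of the
normal speed vanishes there. -/
theorem arcDeriv_speed_eq_zero (h : NormalFlow J γ F) (ht : t ∈ J) (hx : x ∈ I) {e : Plane}
    (he : ‖e‖ = 1) (horth : ∀ s ∈ J, inner ℝ (derivWithin (fun y => γ y s) I x) (rot e) = (0 : ℝ)) :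
    arcDeriv (fun y => γ y t) (fun y => F y t) x = 0 := by
  have h0 : ∀ s ∈ J, inner ℝ (tangent (fun y => γ y s) x) (rot e) = (0 : ℝ) := fun s hs => by
    rw [tangent, arcDeriv, real_inner_smul_left, horth s hs, mul_zero]
  have h1 := (h.hasDerivAt_tangent ht hx).inner ℝ (hasDerivAt_const t (rot e))
  have h2 := (hasDerivAt_const t (0 : ℝ)).congr_of_eventuallyEq
    (f₁ := fun s => inner ℝ (tangent (fun y => γ y s) x) (rot e)) (by
      filter_upwards [h.isOpen.mem_nhds ht] with s hs using h0 s hs)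
  have h3 := h1.unique h2
  rw [inner_zero_right, zero_add, real_inner_smul_left, normal, inner_rot_rot] at h3
  -- Differentiating in time gives F_s⟨τ, e⟩ = 0. The second factor is nonzero because τ, orthogonal
  -- to `rot e`, is ±e.
  refine (mul_eq_zero.1 h3).resolve_right fun h4 => ?_
  have h5 := inner_sq_add_inner_rot_sq (tangent (fun y => γ y t) x) e
  rw [h4, h0 t ht, norm_tangent (h.regular t ht) hx, he] at h5
  norm_num at h5

end NormalFlow

/-! ### Dependence on the curve only through its values on the interval -/

section Congr

variable {c c' : ℝ → Plane}

theorem speed_congr (h : EqOn c c' I) {x : ℝ} (hx : x ∈ I) : speed c x = speed c' x := by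
  rw [speed, speed, derivWithin_congr h (h hx)]

theorem arcDeriv_congr (h : EqOn c c' I) {E : Type} [NormedAddCommGroup E] [NormedSpace ℝ E]
    {f f' : ℝ → E} (hf : EqOn f f' I) : EqOn (arcDeriv c f) (arcDeriv c' f') I := fun x hx => by
  rw [arcDeriv, arcDeriv, speed_congr h hx, derivWithin_congr hf (hf hx)]

theorem curvatureDeriv_congr (h : EqOn c c' I) (j : ℕ) :
    EqOn (curvatureDeriv c j) (curvatureDeriv c' j) I := by
  have ht : EqOn (tangent c) (tangent c') I := arcDeriv_congr h h
  induction j with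
  | zero =>
    intro x hx
    change curvature c x = curvature c' x
    rw [curvature, curvature, normal, normal, ht hx, arcDeriv_congr h ht hx]
  | succ j ih =>
    rw [← arcDeriv_curvatureDeriv, ← arcDeriv_curvatureDeriv]
    exact arcDeriv_congr h ih

theorem arcIntegral_congr_curve (h : EqOn c c' I) {f f' : ℝ → ℝ} (hf : EqOn f f' I) :
    arcIntegral c f = arcIntegral c' f' := by
  refine intervalIntegral.integral_congr fun x hx => ?_
  rw [uIcc_eq_I] at hx
  simp only [hf hx, speed_congr h hx]

theorem energy_congr (h : EqOn c c' I) (j : ℕ) : energy j c = energy j c' :=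
  arcIntegral_congr_curve h fun x hx => by simp only [curvatureDeriv_congr h j hx]

theorem length_congr (h : EqOn c c' I) : length c = length c' :=
  arcIntegral_congr_curve h fun _ _ => rfl

end Congr

/-! ### Regularity of the normal speed and continuity down to the initial time -/

section Regularity

variable {c : ℝ → Plane}

theorem contDiffOn_flowSpeed (hc : ContDiffOn ℝ ∞ c I) (hr : IsRegular c) (m : ℕ) :
    ContDiffOn ℝ ∞ (flowSpeed m c) I := by
  have hk := contDiffOn_curvatureDeriv hc hr
  have hk0 := contDiffOn_curvature hc hr
  exact ((contDiffOn_const.mul (hk _)).sub (ContDiffOn.sum fun j _ =>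
    contDiffOn_const.mul ((hk0.mul (hk _)).mul (hk _)))).sub
    ((contDiffOn_const.mul hk0).mul ((hk _).pow 2))

/-- The curvature in terms of the derivatives of a parametrisation. -/
theorem curvature_eq (hc : ContDiffOn ℝ ∞ c I) (hr : IsRegular c) {x : ℝ} (hx : x ∈ I) :
    curvature c x = (speed c x ^ 3)⁻¹ *
      inner ℝ (iteratedDerivWithin 2 c I x) (rot (iteratedDerivWithin 1 c I x)) := by
  have hv := (speed_pos hr hx).ne'
  have h1 := (differentiableWithinAt_of_smooth (contDiffOn_speed hc hr) hx).hasDerivWithinAt.smul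
    (hasDerivWithinAt_tangent hc hr hx)
  have h2 := h1.congr (f₁ := derivWithin c I) (fun y hy => derivWithin_eq_smul_tangent hr hy)
    (derivWithin_eq_smul_tangent hr hx)
  have h3 : iteratedDerivWithin 2 c I x = derivWithin (derivWithin c I) I x := by
    rw [iteratedDerivWithin_succ]
    rw [iteratedDerivWithin_one]
  rw [h3, iteratedDerivWithin_one, h2.derivWithin (uniqueDiffOn_I x hx),
    derivWithin_eq_smul_tangent hr hx, rot_smul, inner_add_left, real_inner_smul_left,
    real_inner_smul_left, real_inner_smul_right, real_inner_smul_left, real_inner_smul_right]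
  rw [← normal, inner_normal_self hr hx, normal, inner_rot_self]
  field_simp
  ring

end Regularity

theorem continuousOn_integral_strip {g : ℝ → ℝ → ℝ} {b : ℝ} (hb : 0 ≤ b)
    (hg : ContinuousOn (fun p : ℝ × ℝ => g p.1 p.2) (I ×ˢ Icc 0 b)) :
    ContinuousOn (fun t => ∫ x in (-1 : ℝ)..1, g x t) (Icc 0 b) := by
  have h11 : (-1 : ℝ) ≤ 1 := by norm_num
  -- Composing with the projections onto the intervals extends the integrand continuously to the
  -- whole plane.
  have hG : Continuous (fun p : ℝ × ℝ =>
      g (projIcc (-1) 1 h11 p.2) (projIcc 0 b hb p.1)) :=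
    hg.comp_continuous (f := fun p : ℝ × ℝ =>
      ((projIcc (-1) 1 h11 p.2 : ℝ), (projIcc 0 b hb p.1 : ℝ)))
      (((continuous_subtype_val.comp continuous_projIcc).comp continuous_snd).prodMk
        ((continuous_subtype_val.comp continuous_projIcc).comp continuous_fst))
      fun p => ⟨Subtype.coe_prop _, Subtype.coe_prop _⟩
  have h := intervalIntegral.continuous_parametric_intervalIntegral_of_continuous'
    (μ := volume) (f := fun t x => g (projIcc (-1) 1 h11 x) (projIcc 0 b hb t)) hG (-1) 1
  refine h.continuousOn.congr fun t ht => intervalIntegral.integral_congr fun x hx => ?_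
  rw [uIcc_eq_I] at hx
  simp only [projIcc_of_mem h11 hx, projIcc_of_mem hb ht]

/-- Two positive quantities whose derivatives are controlled as long as their product is small:
if the product is small initially, it remains so and the second one decays exponentially. -/
theorem exp_decay_of_small {L K L' K' : ℝ → ℝ} {b ε : ℝ} {p : ℕ} (hb : 0 ≤ b)
    (hLc : ContinuousOn L (Icc 0 b)) (hKc : ContinuousOn K (Icc 0 b))
    (hL0 : ∀ t ∈ Icc 0 b, 0 < L t) (hK0 : ∀ t ∈ Icc 0 b, 0 ≤ K t)
    (hL : ∀ t ∈ Ioo 0 b, HasDerivAt L (L' t) t) (hK : ∀ t ∈ Ioo 0 b, HasDerivAt K (K' t) t)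
    (hsmall : ∀ t ∈ Ioo 0 b, L t * K t ≤ ε → L' t ≤ 0 ∧ K t ≤ -((2 * L t) ^ p * K' t))
    (hinit : L 0 * K 0 < ε) :
    K b ≤ K 0 * Real.exp (-((2 * L 0) ^ p)⁻¹ * b) := by
  have h0 : (0 : ℝ) ∈ Icc 0 b := ⟨le_rfl, hb⟩
  have hanti : ∀ s ∈ Icc 0 b, (∀ t ∈ Ioo 0 s, L t * K t ≤ ε) →
      AntitoneOn L (Icc 0 s) ∧ AntitoneOn K (Icc 0 s) := by
    intro s hs hle
    have hsub : Icc 0 s ⊆ Icc 0 b := Icc_subset_Icc_right hs.2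
    have hsub' : Ioo 0 s ⊆ Ioo 0 b := Ioo_subset_Ioo_right hs.2
    constructor
    · refine antitoneOn_of_hasDerivWithinAt_nonpos (convex_Icc 0 s) (hLc.mono hsub) (f' := L')
        (fun t ht => ?_) (fun t ht => ?_)
      · rw [interior_Icc] at ht
        exact (hL t (hsub' ht)).hasDerivWithinAt
      · rw [interior_Icc] at ht
        exact (hsmall t (hsub' ht) (hle t ht)).1
    · refine antitoneOn_of_hasDerivWithinAt_nonpos (convex_Icc 0 s) (hKc.mono hsub) (f' := K')
        (fun t ht => ?_) (fun t ht => ?_)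
      · rw [interior_Icc] at ht
        exact (hK t (hsub' ht)).hasDerivWithinAt
      · rw [interior_Icc] at ht
        have h1 := (hsmall t (hsub' ht) (hle t ht)).2
        have h2 := hK0 t (hsub (Ioo_subset_Icc_self ht))
        have h3 : 0 < (2 * L t) ^ p :=
          pow_pos (mul_pos two_pos (hL0 t (hsub (Ioo_subset_Icc_self ht)))) p
        by_contra! hneg
        have := mul_pos h3 hneg
        linarith
  have hlt : ∀ t ∈ Icc 0 b, L t * K t < ε := by
    by_contra! hex
    have hclosed : IsClosed (Icc 0 b ∩ (fun t => L t * K t) ⁻¹' Ici ε) :=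
      (hLc.mul hKc).preimage_isClosed_of_isClosed isClosed_Icc isClosed_Ici
    have hbdd : BddBelow (Icc 0 b ∩ (fun t => L t * K t) ⁻¹' Ici ε) := ⟨0, fun t ht => ht.1.1⟩
    have hne : (Icc 0 b ∩ (fun t => L t * K t) ⁻¹' Ici ε).Nonempty := by
      obtain ⟨t, ht, hte⟩ := hex
      exact ⟨t, ht, hte⟩
    obtain ⟨hs, hse⟩ := hclosed.csInf_mem hne hbdd
    -- At the first time s where the product reaches ε, both factors have been nonincreasing on [0,
    -- s], so the product is at most its initial value, which is below ε.
    set s := sInf (Icc 0 b ∩ (fun t => L t * K t) ⁻¹' Ici ε) with hsdef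
    obtain ⟨hA, hB⟩ := hanti s hs fun t ht => by
      by_contra! hgt
      exact absurd (csInf_le hbdd ⟨⟨ht.1.le, ht.2.le.trans hs.2⟩, hgt.le⟩) (not_le.2 ht.2)
    have h1 := hA ⟨le_rfl, hs.1⟩ ⟨hs.1, le_rfl⟩ hs.1
    have h2 := hB ⟨le_rfl, hs.1⟩ ⟨hs.1, le_rfl⟩ hs.1
    have h3 := mul_le_mul h1 h2 (hK0 s hs) (hL0 0 h0).le
    exact absurd hse (not_le.2 (h3.trans_lt hinit))
  obtain ⟨hA, hB⟩ := hanti b ⟨hb, le_rfl⟩ fun t ht => (hlt t (Ioo_subset_Icc_self ht)).le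
  set δ := ((2 * L 0) ^ p)⁻¹ with hδ
  have hpos : 0 < (2 * L 0) ^ p := pow_pos (mul_pos two_pos (hL0 0 h0)) p
  have hfinal : AntitoneOn (fun t => K t * Real.exp (δ * t)) (Icc 0 b) := by
    refine antitoneOn_of_hasDerivWithinAt_nonpos (convex_Icc 0 b)
      (hKc.mul (by fun_prop)) (f' := fun t => K' t * Real.exp (δ * t) +
        K t * (Real.exp (δ * t) * (δ * 1))) (fun t ht => ?_) (fun t ht => ?_)
    · rw [interior_Icc] at ht
      exact ((hK t ht).mul (((hasDerivAt_id t).const_mul δ).exp)).hasDerivWithinAt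
    · rw [interior_Icc] at ht
      have htI := Ioo_subset_Icc_self ht
      have h1 := (hsmall t ht (hlt t htI).le).2
      have hKt := hK0 t htI
      have hLt := hL0 t htI
      have hK'0 : 0 ≤ -K' t := by
        have h3 : 0 < (2 * L t) ^ p := by positivity
        by_contra! hneg
        have := mul_pos h3 (neg_neg_iff_pos.1 hneg)
        linarith
      -- Monotonicity of L replaces L(t) by L(0), making the decay rate independent of time.
      have h2 : (2 * L t) ^ p ≤ (2 * L 0) ^ p :=
        pow_le_pow_left₀ (by positivity) (by linarith [hA h0 htI ht.1.le]) p
      have h4 : K t ≤ (2 * L 0) ^ p * -K' t := by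
        have := mul_le_mul_of_nonneg_right h2 hK'0
        linarith
      have h5 : δ * K t ≤ -K' t := by
        rw [hδ, inv_mul_le_iff₀ hpos]; exact h4
      have := Real.exp_pos (δ * t)
      nlinarith
  have h := hfinal h0 ⟨hb, le_rfl⟩ hb
  simp only [mul_zero, Real.exp_zero, mul_one] at h
  rw [neg_mul, Real.exp_neg, ← div_eq_mul_inv, le_div_iff₀ (Real.exp_pos _)]
  exact h

/-! ### Application to solutions of the flow -/

namespace IsSolution

variable {m : ℕ} {e : Plane} {a d : ℝ} {γ₀ : ℝ → Plane} {T : EReal} {γ : ℝ → ℝ → Plane}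

theorem isOpen_times (T : EReal) : IsOpen {t : ℝ | 0 < t ∧ (t : EReal) < T} :=
  (isOpen_lt continuous_const continuous_id).inter
    (isOpen_lt continuous_coe_real_ereal continuous_const)

theorem contDiffOn_slice (h : IsSolution m e a d γ₀ T γ) (hγ₀ : ContDiffOn ℝ ∞ γ₀ I) {t : ℝ}
    (ht : 0 ≤ t) (htT : (t : EReal) < T) : ContDiffOn ℝ ∞ (fun y => γ y t) I := by
  rcases ht.eq_or_lt with rfl | ht
  · exact hγ₀.congr h.initial
  · exact CurveFlow.contDiffOn_slice h.smooth ⟨ht, htT⟩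

theorem normalFlow (h : IsSolution m e a d γ₀ T γ) :
    NormalFlow {t : ℝ | 0 < t ∧ (t : EReal) < T} γ fun x t => flowSpeed m (fun y => γ y t) x where
  isOpen := isOpen_times T
  smooth := h.smooth
  regular t ht := h.regular t ht.1.le ht.2
  smooth_speed t ht := contDiffOn_flowSpeed (CurveFlow.contDiffOn_slice h.smooth ht)
    (h.regular t ht.1.le ht.2) m
  flow t ht x hx := h.flow t ht.1 ht.2 x hx

variable {b : ℝ}

theorem lt_of_mem_Icc (hbT : (b : EReal) < T) {t : ℝ} (ht : t ∈ Icc 0 b) : (t : EReal) < T :=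
  (EReal.coe_le_coe_iff.2 ht.2).trans_lt hbT

theorem continuousOn_iteratedDerivWithin (h : IsSolution m e a d γ₀ T γ) (hbT : (b : EReal) < T)
    {i : ℕ} (hi : i ≤ m + 2) :
    ContinuousOn (fun p : ℝ × ℝ => iteratedDerivWithin i (fun x => γ x p.2) I p.1)
      (I ×ˢ Icc 0 b) :=
  (h.continuous i hi).mono (prod_mono_right fun _ ht => ⟨ht.1, lt_of_mem_Icc hbT ht⟩)

theorem continuousOn_speed (h : IsSolution m e a d γ₀ T γ) (hbT : (b : EReal) < T) :
    ContinuousOn (fun p : ℝ × ℝ => speed (fun y => γ y p.2) p.1) (I ×ˢ Icc 0 b) := by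
  have := (h.continuousOn_iteratedDerivWithin hbT (i := 1) (by omega)).norm
  simp only [iteratedDerivWithin_one] at this
  exact this

theorem continuousOn_curvature (h : IsSolution m e a d γ₀ T γ) (hγ₀ : ContDiffOn ℝ ∞ γ₀ I)
    (hbT : (b : EReal) < T) :
    ContinuousOn (fun p : ℝ × ℝ => curvature (fun y => γ y p.2) p.1) (I ×ˢ Icc 0 b) := by
  have h1 := h.continuousOn_iteratedDerivWithin hbT (i := 1) (by omega)
  have h2 := h.continuousOn_iteratedDerivWithin hbT (i := 2) (by omega)
  have hreg : ∀ p ∈ I ×ˢ Icc 0 b, IsRegular fun y => γ y p.2 := fun p hp =>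
    h.regular p.2 hp.2.1 (lt_of_mem_Icc hbT hp.2)
  -- The formula for k uses only first and second parameter derivatives, whose continuity down to t
  -- = 0 is part of the notion of solution.
  refine ((((h.continuousOn_speed hbT).pow 3).inv₀ fun p hp =>
    pow_ne_zero 3 (speed_pos (hreg p hp) hp.1).ne').mul
    (h2.inner (𝕜 := ℝ) (rotL.continuous.comp_continuousOn h1))).congr fun p hp => ?_
  exact curvature_eq (h.contDiffOn_slice hγ₀ hp.2.1 (lt_of_mem_Icc hbT hp.2)) (hreg p hp) hp.1

/-- The normal speed has vanishing derivative at the end points. -/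
theorem arcDeriv_flowSpeed_eq_zero (h : IsSolution m e a d γ₀ T γ) (he : ‖e‖ = 1) {t : ℝ}
    (ht : 0 < t) (htT : (t : EReal) < T) {x : ℝ} (hx : x ∈ ({-1, 1} : Set ℝ)) :
    arcDeriv (fun y => γ y t) (flowSpeed m fun y => γ y t) x = 0 := by
  have hxI : x ∈ I := by
    rcases hx with rfl | rfl
    · exact left_mem_I
    · exact right_mem_I
  exact h.normalFlow.arcDeriv_speed_eq_zero ⟨ht, htT⟩ hxI he fun s hs =>
    (h.boundary s hs.1.le hs.2).orthogonal x hx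

/-- The total curvature is preserved. -/
theorem arcIntegral_curvature_eq (h : IsSolution m e a d γ₀ T γ) (hγ₀ : ContDiffOn ℝ ∞ γ₀ I)
    (he : ‖e‖ = 1) (hb : 0 ≤ b) (hbT : (b : EReal) < T) :
    arcIntegral (fun y => γ y b) (curvature fun y => γ y b) =
      arcIntegral γ₀ (curvature γ₀) := by
  have hcont : ContinuousOn (fun t => arcIntegral (fun y => γ y t) (curvature fun y => γ y t))
      (Icc 0 b) := continuousOn_integral_strip hb
    ((h.continuousOn_curvature hγ₀ hbT).mul (h.continuousOn_speed hbT))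
  have hderiv : ∀ t ∈ interior (Icc 0 b), HasDerivWithinAt
      (fun t => arcIntegral (fun y => γ y t) (curvature fun y => γ y t)) 0
      (interior (Icc 0 b)) t := by
    intro t ht
    rw [interior_Icc] at ht ⊢
    have htT := lt_of_mem_Icc hbT (Ioo_subset_Icc_self ht)
    have h1 := h.normalFlow.hasDerivAt_arcIntegral_curvature ⟨ht.1, htT⟩
    have e1 := h.arcDeriv_flowSpeed_eq_zero he ht.1 htT (x := 1) (by simp)
    have e2 := h.arcDeriv_flowSpeed_eq_zero he ht.1 htT (x := -1) (by simp)
    refine (h1.congr_deriv ?_).hasDerivWithinAt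
    change arcDeriv _ (flowSpeed m fun y => γ y t) 1 -
      arcDeriv _ (flowSpeed m fun y => γ y t) (-1) = 0
    rw [e1, e2, sub_zero]
  have hanti := antitoneOn_of_hasDerivWithinAt_nonpos (convex_Icc 0 b) hcont hderiv
    fun _ _ => le_rfl
  have hmono := monotoneOn_of_hasDerivWithinAt_nonneg (convex_Icc 0 b) hcont hderiv
    fun _ _ => le_rfl
  have heq := le_antisymm (hanti ⟨le_rfl, hb⟩ ⟨hb, le_rfl⟩ hb) (hmono ⟨le_rfl, hb⟩ ⟨hb, le_rfl⟩ hb)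
  refine heq.trans (arcIntegral_congr_curve h.initial fun x hx => ?_)
  exact curvatureDeriv_congr h.initial 0 hx

theorem balancedCurve (h : IsSolution m e a d γ₀ T γ) (hγ₀ : ContDiffOn ℝ ∞ γ₀ I)
    (he : ‖e‖ = 1) (hk : arcIntegral γ₀ (curvature γ₀) = 0) (hb : 0 ≤ b)
    (hbT : (b : EReal) < T) : BalancedCurve m fun y => γ y b where
  smooth := h.contDiffOn_slice hγ₀ hb hbT
  regular := h.regular b hb hbT
  odd_deriv := (h.boundary b hb hbT).odd_deriv
  integral_curvature := (h.arcIntegral_curvature_eq hγ₀ he hb hbT).trans hk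

theorem energy_zero_le (h : IsSolution m e a d γ₀ T γ) (hγ₀ : ContDiffOn ℝ ∞ γ₀ I)
    (he : ‖e‖ = 1) (hk : arcIntegral γ₀ (curvature γ₀) = 0)
    (hinit : length γ₀ * energy 0 γ₀ < smallness m) (hb : 0 ≤ b) (hbT : (b : EReal) < T) :
    energy 0 (fun y => γ y b) ≤
      energy 0 γ₀ * Real.exp (-((2 * length γ₀) ^ (2 * (m + 2)))⁻¹ * b) := by
  rw [← energy_congr h.initial, ← length_congr h.initial] at hinit ⊢
  have hbal : ∀ t ∈ Icc 0 b, BalancedCurve m fun y => γ y t := fun t ht =>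
    h.balancedCurve hγ₀ he hk ht.1 (lt_of_mem_Icc hbT ht)
  have hmem : ∀ t ∈ Ioo 0 b, t ∈ {t : ℝ | 0 < t ∧ (t : EReal) < T} := fun t ht =>
    ⟨ht.1, lt_of_mem_Icc hbT (Ioo_subset_Icc_self ht)⟩
  refine exp_decay_of_small (L := fun t => length fun y => γ y t)
    (K := fun t => energy 0 fun y => γ y t) (ε := smallness m) hb
    (continuousOn_integral_strip hb (continuousOn_const.mul (h.continuousOn_speed hbT)))
    (continuousOn_integral_strip hb
      (((h.continuousOn_curvature hγ₀ hbT).pow 2).mul (h.continuousOn_speed hbT)))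
    (fun t ht => length_pos (hbal t ht).smooth (hbal t ht).regular)
    (fun t _ => energy_nonneg 0)
    (fun t ht => h.normalFlow.hasDerivAt_length (hmem t ht))
    (fun t ht => h.normalFlow.hasDerivAt_energy_zero (hmem t ht)
      ⟨h.arcDeriv_flowSpeed_eq_zero he (hmem t ht).1 (hmem t ht).2 (by simp),
        h.arcDeriv_flowSpeed_eq_zero he (hmem t ht).1 (hmem t ht).2 (by simp)⟩
      ((hbal t (Ioo_subset_Icc_self ht)).eq_zero_of_odd odd_one (by omega)))
    (fun t ht hs => ?_) hinit
  have hB := hbal t (Ioo_subset_Icc_self ht)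
  have hL := length_pos hB.smooth hB.regular
  refine ⟨neg_nonpos.2 (hB.arcIntegral_curvature_mul_flowSpeed_nonneg hs), ?_⟩
  refine (hB.energy_zero_le (n := m + 2) (by omega)).trans ?_
  rw [← mul_neg, ← curvatureNorm_sq (m + 2)]
  exact mul_le_mul_of_nonneg_left (le_neg_of_le_neg (hB.dissipation hs)) (by positivity)

end IsSolution

end CurveFlow

theorem proposition4p5 (m : ℕ) :
    ∃ c : ℝ, 0 < c ∧ ∀ L₀ : ℝ, 0 < L₀ → ∃ δ : ℝ, 0 < δ ∧
      ∀ (e : CurveFlow.Plane) (a d : ℝ) (γ₀ : ℝ → CurveFlow.Plane) (T : EReal)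
        (γ : ℝ → ℝ → CurveFlow.Plane),
        ‖e‖ = 1 → 0 < d → 0 < T →
        ContDiffOn ℝ ∞ γ₀ CurveFlow.I → CurveFlow.IsRegular γ₀ →
        CurveFlow.NeumannBC m e a d γ₀ →
        CurveFlow.windingNumber γ₀ = 0 →
        CurveFlow.length γ₀ = L₀ →
        L₀ ^ (2 * m + 1) * CurveFlow.energy m γ₀ ≤ c →
        CurveFlow.IsSolution m e a d γ₀ T γ →
        ∀ t : ℝ, 0 ≤ t → (t : EReal) < T →
          CurveFlow.arcIntegral (fun x => γ x t)
              (fun x => CurveFlow.curvature (fun y => γ y t) x ^ 2) ≤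
            CurveFlow.arcIntegral γ₀ (fun x => CurveFlow.curvature γ₀ x ^ 2) *
              Real.exp (-δ * t) := by
  have hε := CurveFlow.smallness_pos m
  -- Iterating Poincaré m times gives L∫k² ≤ 2^{2m} L^{2m+1}∫k_{s^m}². The additional factor 2
  -- yields the strict initial inequality that the continuity argument requires. The rate is the
  -- Poincaré constant of order m + 2 at the initial length.
  refine ⟨CurveFlow.smallness m / (2 * 2 ^ (2 * m)), by positivity, fun L₀ hL₀ =>
    ⟨((2 * L₀) ^ (2 * (m + 2)))⁻¹, by positivity, ?_⟩⟩
  intro e a d γ₀ T γ he _ _ hγ₀ hreg hbc hw hL hE hsol t ht htT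
  subst hL
  have hk : CurveFlow.arcIntegral γ₀ (CurveFlow.curvature γ₀) = 0 :=
    (mul_eq_zero.1 hw).resolve_left (by positivity)
  have hbal : CurveFlow.BalancedCurve m γ₀ := ⟨hγ₀, hreg, hbc.odd_deriv, hk⟩
  refine hsol.energy_zero_le hγ₀ he hk ?_ ht htT
  have h1 := mul_le_mul_of_nonneg_left (hbal.energy_zero_le (n := m) (by omega)) hL₀.le
  rw [le_div_iff₀ (by positivity)] at hE
  have h2 : CurveFlow.length γ₀ * ((2 * CurveFlow.length γ₀) ^ (2 * m) *
      CurveFlow.energy m γ₀) * 2 =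
      CurveFlow.length γ₀ ^ (2 * m + 1) * CurveFlow.energy m γ₀ * (2 * 2 ^ (2 * m)) := by
    rw [mul_pow]; ring
  linarith
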